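/- Let $(\Omega,\mathcal A)$ be a measurable space and $X=(X_\omega)_{\omega\in\Omega}$ a family of proper CAT(0) spaces with a Borel structure $\mathcal L$. This means that $\mathcal L$ is a set of sections $x=(x_\omega)\in\prod_\omega X_\omega$ such that: (1) $\omega\mapsto d_\omega(x_\omega,y_\omega)$ is measurable for all $x,y\in\mathcal L$; (2) every section $y$ for which all functions $\omega\mapsto d_\omega(x_\omega,y_\omega)$, $x\in\mathcal L$, are measurable belongs to $\mathcal L$; (3) there is a sequence $(x^n)$ in $\mathcal L$ with $\{x^n_\omega\}_n$ dense in $X_\omega$ for every $\omega$. The elements of $\mathcal L$ are called Borel sections. A family of maps between fields with Borel structures is a morphism if it sends Borel sections to Borel sections, and it is continuous if each of its maps is. A family of subsets $A_\omega\subseteq X_\omega$ is a Borel subfield if $\Omega'=\{\omega: A_\omega\ne\emptyset\}$ is measurable and there are Borel sections $y^n$, $n\ge 1$, over $\Omega'$ with $\{y^n_\omega\}_n\subseteq A_\omega\subseteq\overline{\{y^n_\omega\}_n}$ for every $\omega\in\Omega'$; its Borel sections are the Borel sections of the ambient field (over $\Omega'$) with values in $A$. Fix $x^0\in\mathcal L$.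 Equip the space $C(X_\omega)$ of continuous real functions with the metric $$\delta_\omega(f,g)=\inf\Big\{\varepsilon>0:\ \sup_{x\in B(x^0_\omega,1/\varepsilon)}|f(x)-g(x)|<\varepsilon\Big\}$$ and let the Borel sections of the field $C(X)=(C(X_\omega))_\omega$ be the sections $f$ for which $\omega\mapsto f_\omega(x_\omega)$ is measurable for every $x\in\mathcal L$. Let $C_0(X_\omega)=\{f\in C(X_\omega): f(x^0_\omega)=0\}$, with the inherited metric and Borel sections. Let $i_\omega:X_\omega\to C_0(X_\omega)$, $i_\omega(x)=d_\omega(x,\cdot)-d_\omega(x,x^0_\omega)$. Let $\partial X_\omega$ be the visual boundary (geodesic rays $[0,\infty)\to X_\omega$ modulo staying at bounded distance), where $\xi\in\partial X_\omega$ is identified with its Busemann function $b_{x^0_\omega,\xi}(x)=\lim_{t\to\infty}\big(d_\omega(x,c(t))-d_\omega(x^0_\omega,c(t))\big)$, $c$ being the geodesic ray from $x^0_\omega$ in the class $\xi$. Then $C(X)$ is a Borel field, $C_0(X)$ is a Borel subfield of it, hence itself a Borel field, and: (i) $i=(i_\omega)$ is a continuous morphism from $X$ to $C_0(X)$, and the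 subfields $i(X)$ and $\overline{i(X)}$ of $C_0(X)$ are Borel; in particular $\overline{i(X)}$ is a Borel field. (ii) For every $\omega$, each $\xi\in\partial X_\omega$ has exactly one Busemann function based at $x^0_\omega$, distinct points of $\partial X_\omega$ have distinct Busemann functions, and these functions lie in $\overline{i_\omega(X_\omega)}$. With this identification, $\partial X_\omega$ is closed in $\overline{i_\omega(X_\omega)}$ for every $\omega$, and $\partial X$ is a Borel subfield of $\overline{i(X)}$. -/

import Mathlib

open Set Filter Topology

noncomputable section

/-! ### Borel fields of metric spaces -/

/-- A Borel structure on the field of metric spaces `(X ω)` over the measurable space `Ω`: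
a set `L` of sections which is compatible, maximal and separable. -/
structure IsBorelStructure {Ω : Type*} [MeasurableSpace Ω] {X : Ω → Type*}
    [∀ ω, MetricSpace (X ω)] (L : Set (∀ ω, X ω)) : Prop where
  compatible : ∀ x ∈ L, ∀ y ∈ L, Measurable fun ω => dist (x ω) (y ω)
  maximal : ∀ y : ∀ ω, X ω, (∀ x ∈ L, Measurable fun ω => dist (x ω) (y ω)) → y ∈ L
  separable : ∃ D : ℕ → ∀ ω, X ω, (∀ n, D n ∈ L) ∧ ∀ ω, closure (range fun n => D n ω) = univ

/-- A morphism of Borel fields: a family of maps that sends Borel sections to Borel sections. -/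
def IsBorelMorphism {Ω : Type*} {X Y : Ω → Type*} (LX : Set (∀ ω, X ω)) (LY : Set (∀ ω, Y ω))
    (φ : ∀ ω, X ω → Y ω) : Prop :=
  ∀ x ∈ LX, (fun ω => φ ω (x ω)) ∈ LY

/-- A continuous morphism of Borel fields of metric spaces. -/
def IsContinuousBorelMorphism {Ω : Type*} {X Y : Ω → Type*} [∀ ω, MetricSpace (X ω)]
    [∀ ω, MetricSpace (Y ω)] (LX : Set (∀ ω, X ω)) (LY : Set (∀ ω, Y ω))
    (φ : ∀ ω, X ω → Y ω) : Prop :=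
  IsBorelMorphism LX LY φ ∧ ∀ ω, Continuous (φ ω)

/-- A subfield `A` of the Borel field `(X, L)` (where `A ω` may be empty) is Borel if its base
`{ω | A ω ≠ ∅}` is measurable and there are countably many Borel sections which, over the base,
take values in `A` and are dense in `A`. (Borel sections over the base are by definition the
restrictions of elements of `L`, so the values of `y n` outside the base are irrelevant.) -/
def IsBorelSubfield {Ω : Type*} [MeasurableSpace Ω] {X : Ω → Type*} [∀ ω, MetricSpace (X ω)]
    (L : Set (∀ ω, X ω)) (A : ∀ ω, Set (X ω)) : Prop :=
  MeasurableSet {ω | (A ω).Nonempty} ∧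
    ∃ y : ℕ → ∀ ω, X ω, (∀ n, y n ∈ L) ∧
      ∀ ω, (A ω).Nonempty →
        (∀ n, y n ω ∈ A ω) ∧ A ω ⊆ closure (range fun n => y n ω)

/-- The structure inherited by a subfield of full base `Ω`: the Borel sections of the ambient field
with values in the subfield. -/
def inheritedStructure {Ω : Type*} {X : Ω → Type*} (L : Set (∀ ω, X ω)) (A : ∀ ω, Set (X ω)) :
    Set (∀ ω, A ω) :=
  {y | (fun ω => (y ω : X ω)) ∈ L}

/-! ### Continuous functions on a pointed proper metric space -/

/-- The space of continuous real functions on `X`, metrized with the help of the base point `x₀`. -/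
def PointedContFun (X : Type*) [MetricSpace X] (_x₀ : X) : Type _ := C(X, ℝ)

namespace PointedContFun

variable {X : Type*} [MetricSpace X] {x₀ : X}

instance : FunLike (PointedContFun X x₀) X ℝ := inferInstanceAs (FunLike C(X, ℝ) X ℝ)

theorem continuous_coe (f : PointedContFun X x₀) : Continuous (f : X → ℝ) :=
  ContinuousMap.continuous (show C(X, ℝ) from f)

/-- `radii f g` is the set of all `ε > 0` with `sup_{x ∈ B(x₀, 1/ε)} |f x - g x| < ε`. -/
def radii (f g : PointedContFun X x₀) : Set ℝ :=
  {ε | 0 < ε ∧ (⨆ x : Metric.ball x₀ (1 / ε), |f x - g x|) < ε}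

theorem bddAbove_ball [ProperSpace X] (f g : PointedContFun X x₀) (r : ℝ) :
    BddAbove (range fun x : Metric.ball x₀ r => |f x - g x|) := by
  have hc : Continuous fun x : X => |f x - g x| := (f.continuous_coe.sub g.continuous_coe).abs
  obtain ⟨M, hM⟩ := (isCompact_closedBall x₀ r).bddAbove_image hc.continuousOn
  refine ⟨M, ?_⟩
  rintro _ ⟨x, rfl⟩
  exact hM ⟨x, Metric.ball_subset_closedBall x.2, rfl⟩

theorem abs_lt_of_mem_radii [ProperSpace X] {f g : PointedContFun X x₀} {ε : ℝ}
    (h : ε ∈ radii f g) {x : X} (hx : dist x x₀ < 1 / ε) : |f x - g x| < ε :=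
  (le_ciSup (bddAbove_ball f g (1 / ε)) ⟨x, hx⟩).trans_lt h.2

theorem iSup_ball_le (f g : PointedContFun X x₀) {r M : ℝ} (hr : 0 < r)
    (h : ∀ x, dist x x₀ < r → |f x - g x| ≤ M) :
    (⨆ x : Metric.ball x₀ r, |f x - g x|) ≤ M := by
  have : Nonempty (Metric.ball x₀ r) := ⟨⟨x₀, Metric.mem_ball_self hr⟩⟩
  exact ciSup_le fun x => h x x.2

theorem radii_nonempty [ProperSpace X] (f g : PointedContFun X x₀) : (radii f g).Nonempty := by
  obtain ⟨M, hM⟩ := bddAbove_ball f g 1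
  have hpos : (0 : ℝ) < max 1 (M + 1) := lt_of_lt_of_le one_pos (le_max_left _ _)
  refine ⟨max 1 (M + 1), hpos, ?_⟩
  refine lt_of_le_of_lt (iSup_ball_le f g (M := M) (by positivity) ?_)
    (lt_of_lt_of_le (lt_add_one M) (le_max_right _ _))
  intro x hx
  have h1 : 1 / max 1 (M + 1) ≤ 1 := by
    rw [div_le_one hpos]
    exact le_max_left _ _
  exact hM ⟨⟨x, hx.trans_le h1⟩, rfl⟩

theorem radii_bddBelow (f g : PointedContFun X x₀) : BddBelow (radii f g) :=
  ⟨0, fun _ h => h.1.le⟩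

theorem radii_comm (f g : PointedContFun X x₀) : radii f g = radii g f := by
  simp only [radii, abs_sub_comm]

/-- The distance `δ(f, g) = inf {ε > 0 | sup_{x ∈ B(x₀, 1/ε)} |f x - g x| < ε}`. -/
instance : Dist (PointedContFun X x₀) := ⟨fun f g => sInf (radii f g)⟩

theorem dist_def (f g : PointedContFun X x₀) :
    dist f g = sInf {ε : ℝ | 0 < ε ∧ (⨆ x : Metric.ball x₀ (1 / ε), |f x - g x|) < ε} := rfl

theorem exists_radius [ProperSpace X] {f g : PointedContFun X x₀} {a : ℝ} (h : dist f g < a) :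
    ∃ ε ∈ radii f g, ε < a :=
  exists_lt_of_csInf_lt (radii_nonempty f g) h

theorem add_mem_radii [ProperSpace X] {f g h : PointedContFun X x₀} {a b : ℝ}
    (ha : a ∈ radii f g) (hb : b ∈ radii g h) : a + b ∈ radii f h := by
  have ha0 := ha.1
  have hb0 := hb.1
  refine ⟨by linarith, ?_⟩
  refine lt_of_le_of_lt (iSup_ball_le f h
    (M := (⨆ x : Metric.ball x₀ (1 / a), |f x - g x|) +
      ⨆ x : Metric.ball x₀ (1 / b), |g x - h x|) (by positivity) ?_) (add_lt_add ha.2 hb.2)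
  intro x hx
  have hxa : dist x x₀ < 1 / a :=
    hx.trans_le (one_div_le_one_div_of_le ha0 (by linarith))
  have hxb : dist x x₀ < 1 / b :=
    hx.trans_le (one_div_le_one_div_of_le hb0 (by linarith))
  exact (abs_sub_le (f x) (g x) (h x)).trans (add_le_add
    (le_ciSup (bddAbove_ball f g (1 / a)) ⟨x, hxa⟩)
    (le_ciSup (bddAbove_ball g h (1 / b)) ⟨x, hxb⟩))

instance [ProperSpace X] : MetricSpace (PointedContFun X x₀) where
  dist_self f := by
    refine le_antisymm (le_of_forall_pos_le_add fun ε hε => ?_)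
      (le_csInf (radii_nonempty f f) fun _ h => h.1.le)
    rw [zero_add]
    refine csInf_le (radii_bddBelow f f) ⟨hε, ?_⟩
    exact lt_of_le_of_lt (iSup_ball_le f f (M := 0) (by positivity) (by simp)) hε
  dist_comm f g := congrArg sInf (radii_comm f g)
  dist_triangle f g h := by
    refine le_of_forall_pos_le_add fun ε hε => ?_
    obtain ⟨a, ha, ha'⟩ := exists_radius (lt_add_of_pos_right (dist f g) (half_pos hε))
    obtain ⟨b, hb, hb'⟩ := exists_radius (lt_add_of_pos_right (dist g h) (half_pos hε))
    have : dist f h ≤ a + b := csInf_le (radii_bddBelow f h) (add_mem_radii ha hb)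
    linarith
  eq_of_dist_eq_zero {f g} h0 := by
    refine DFunLike.ext f g fun x => ?_
    refine eq_of_abs_sub_eq_zero (le_antisymm (le_of_forall_pos_le_add fun η hη => ?_)
      (abs_nonneg _))
    have hd : (0 : ℝ) < dist x x₀ + 1 := by positivity
    have hpos : dist f g < min η (1 / (dist x x₀ + 1)) := by
      rw [h0]
      exact lt_min hη (by positivity)
    obtain ⟨ε, hε, hlt⟩ := exists_radius hpos
    have hx : dist x x₀ < 1 / ε := by
      have h1 : ε < 1 / (dist x x₀ + 1) := hlt.trans_le (min_le_right _ _)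
      rw [lt_div_iff₀ hd] at h1
      rw [lt_div_iff₀ hε.1]
      nlinarith [hε.1]
    have := abs_lt_of_mem_radii hε hx
    have := min_le_left η (1 / (dist x x₀ + 1))
    linarith

end PointedContFun

/-- The continuous functions on `X` that vanish at the base point `x₀`. -/
def contFunZero {X : Type*} [MetricSpace X] (x₀ : X) : Set (PointedContFun X x₀) :=
  {f | f x₀ = 0}

/-- The map `x ↦ d(x, ·) - d(x, x₀)` from `X` to the continuous functions vanishing at `x₀`. -/
def busemannEmbedding {X : Type*} [MetricSpace X] (x₀ : X) (x : X) : contFunZero x₀ :=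
  ⟨(⟨fun y => dist x y - dist x x₀, by fun_prop⟩ : C(X, ℝ)), sub_self (dist x x₀)⟩

/-- The Borel structure on the field of spaces of continuous functions: `f` is a Borel section if
`ω ↦ f_ω(x_ω)` is measurable for every Borel section `x`. -/
def contFunStructure {Ω : Type*} [MeasurableSpace Ω] {X : Ω → Type*} [∀ ω, MetricSpace (X ω)]
    (L : Set (∀ ω, X ω)) (x₀ : ∀ ω, X ω) : Set (∀ ω, PointedContFun (X ω) (x₀ ω)) :=
  {f | ∀ x ∈ L, Measurable fun ω => f ω (x ω)}

/-! ### CAT(0) spaces and their visual boundary -/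

/-- `γ`, restricted to `[0, d(x, y)]`, is a geodesic segment from `x` to `y`. -/
def IsGeodesicSegment {X : Type*} [MetricSpace X] (γ : ℝ → X) (x y : X) : Prop :=
  γ 0 = x ∧ γ (dist x y) = y ∧
    ∀ s ∈ Icc 0 (dist x y), ∀ t ∈ Icc 0 (dist x y), dist (γ s) (γ t) = |s - t|

/-- A CAT(0) space: a geodesic metric space in which the distance from a vertex of a geodesic
triangle to a point of the opposite side is at most the corresponding distance in a Euclidean
comparison triangle. -/
structure IsCAT0 (X : Type*) [MetricSpace X] : Prop where
  geodesic : ∀ x y : X, ∃ γ : ℝ → X, IsGeodesicSegment γ x y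
  comparison : ∀ (x y z : X) (γ : ℝ → X), IsGeodesicSegment γ x y →
    ∀ x' y' z' : EuclideanSpace ℝ (Fin 2),
      dist x' y' = dist x y → dist x' z' = dist x z → dist y' z' = dist y z →
      ∀ t ∈ Icc 0 (dist x y), ∀ q' ∈ segment ℝ x' y', dist x' q' = dist x (γ t) →
        dist z (γ t) ≤ dist z' q'

/-- Geodesic rays: isometric maps from `[0, ∞)` to `X`. -/
structure GeodesicRay (X : Type*) [MetricSpace X] where
  toFun : NNReal → X
  isometry : Isometry toFun

/-- Two geodesic rays are asymptotic if they remain at bounded distance from each other. -/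
def asymptoticSetoid (X : Type*) [MetricSpace X] : Setoid (GeodesicRay X) where
  r c c' := ∃ K : ℝ, ∀ t, dist (c.toFun t) (c'.toFun t) ≤ K
  iseqv :=
    { refl := fun _ => ⟨0, fun t => by simp⟩
      symm := fun ⟨K, h⟩ => ⟨K, fun t => by rw [dist_comm]; exact h t⟩
      trans := fun ⟨K, h⟩ ⟨K', h'⟩ =>
        ⟨K + K', fun t => (dist_triangle _ _ _).trans (add_le_add (h t) (h' t))⟩ }

/-- The visual boundary: classes of asymptotic geodesic rays. -/
def VisualBoundary (X : Type*) [MetricSpace X] : Type _ := Quotient (asymptoticSetoid X)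

/-- `f` is the Busemann function of `ξ` based at `x₀`: for a geodesic ray `c` from `x₀` in the
class `ξ`, one has `f x = lim_{t → ∞} d(x, c t) - d(x₀, c t)` for all `x`. -/
def IsBusemannFunction {X : Type*} [MetricSpace X] (x₀ : X) (ξ : VisualBoundary X)
    (f : X → ℝ) : Prop :=
  ∃ c : GeodesicRay X, c.toFun 0 = x₀ ∧ Quotient.mk (asymptoticSetoid X) c = ξ ∧
    ∀ x, Tendsto (fun t => dist x (c.toFun t) - dist x₀ (c.toFun t)) atTop (𝓝 (f x))

/-- The visual boundary, seen as the set of Busemann functions of its points. -/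
def boundarySet {X : Type*} [MetricSpace X] (x₀ : X) : Set (contFunZero x₀) :=
  {f | ∃ ξ : VisualBoundary X, IsBusemannFunction x₀ ξ f.1}

end

/-! ### Convergence in the space of continuous functions -/

namespace PointedContFun

variable {X : Type*} [MetricSpace X] {x₀ : X}

/-! For the function spaces, everything is tested on a dense sequence of Borel sections $D_n$.
Rational polynomials in the functions $d(D_n,\cdot)$ are dense in $C(X_\omega)$ by Stone–Weierstrass
on balls, and they form countably many Borel sections. Both $\delta$ and point evaluations are then
recovered from countably many measurable data.

The geometric core is `mem_boundarySet_iff`: Busemann functions based at $x_0$ are exactly the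
limits of $i(p)$ as $p$ escapes to infinity. For the converse direction, properness makes the
segments from $x_0$ to $p$ accumulate at a ray $c$. The CAT(0) inequality gives $d(x,\gamma(t))^2\le
t^2+2t\,i(p)(x)+d(x,x_0)^2$ for $\gamma$ the segment to $p$. It survives the limit and forces the
limit function to be the Busemann function of $c$ (`tendsto_busemann`). This description is stable
under limits, so the boundary is closed. Rays from $x_0$ are determined by their class
(`eq_of_asymptotic`) and by their Busemann function (`eq_of_tendsto`).

For measurability, compactness of the $1$-Lipschitz functions vanishing at $x_0$ turns "some
boundary point lies within $a$ of $g$" into a countable condition on the $i(D_n)$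
(`exists_mem_boundarySet_dist_le_iff`). So distances to the boundary are measurable, and a
measurable selection argument (`isBorelSubfield_of_infDist`) produces the dense Borel sections. -/

theorem dist_le_of_forall_abs_le [ProperSpace X] {f g : PointedContFun X x₀} {ε : ℝ} (hε : 0 < ε)
    (h : ∀ x, dist x x₀ < 1 / ε → |f x - g x| ≤ ε) : dist f g ≤ ε := by
  -- Every `ε' > ε` is admissible in the infimum: its ball is smaller and its bound is now strict.
  refine le_of_forall_gt_imp_ge_of_dense fun ε' hε' => ?_
  refine csInf_le (radii_bddBelow f g) ⟨hε.trans hε', ?_⟩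
  refine (iSup_ball_le f g (M := ε) (one_div_pos.2 (hε.trans hε')) fun x hx => ?_).trans_lt hε'
  exact h x (hx.trans (one_div_lt_one_div_of_lt hε hε'))

theorem abs_lt_of_dist_lt [ProperSpace X] {f g : PointedContFun X x₀} {ε : ℝ} (h : dist f g < ε)
    {x : X} (hx : dist x x₀ < 1 / ε) : |f x - g x| < ε := by
  obtain ⟨a, ha, hlt⟩ := exists_radius h
  exact (abs_lt_of_mem_radii ha (hx.trans (one_div_lt_one_div_of_lt ha.1 hlt))).trans hlt

theorem continuous_eval [ProperSpace X] (x : X) :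
    Continuous fun f : PointedContFun X x₀ => f x := by
  refine Metric.continuous_iff.2 fun f ε hε => ?_
  have hd : 0 < dist x x₀ + 1 := by positivity
  refine ⟨min ε (1 / (dist x x₀ + 1)), lt_min hε (by positivity), fun g hg => ?_⟩
  refine (abs_lt_of_dist_lt hg ?_).trans_le (min_le_left _ _)
  have hm : 0 < min ε (1 / (dist x x₀ + 1)) := lt_min hε (by positivity)
  have h1 := min_le_right ε (1 / (dist x x₀ + 1))
  calc dist x x₀ < dist x x₀ + 1 := lt_add_one _
    _ = 1 / (1 / (dist x x₀ + 1)) := by rw [one_div_one_div]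
    _ ≤ _ := one_div_le_one_div_of_le hm h1

/-- Pointwise convergence of `1`-Lipschitz functions on a proper space is uniform on balls. -/
theorem tendsto_of_pointwise [ProperSpace X] {ι : Type*} {l : Filter ι}
    {F : ι → PointedContFun X x₀} {f : PointedContFun X x₀}
    (hF : ∀ᶠ i in l, ∀ x y, |F i x - F i y| ≤ dist x y) (hf : ∀ x y, |f x - f y| ≤ dist x y)
    (h : ∀ x, Tendsto (fun i => F i x) l (𝓝 (f x))) : Tendsto F l (𝓝 f) := by
  refine Metric.tendsto_nhds.2 fun ε hε => ?_
  -- A finite `ε/8`-net of the ball: two Lipschitz errors and one error at a net point add up to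
  -- less than `ε/2`.
  obtain ⟨t, -, ht, hcov⟩ := (isCompact_closedBall x₀ (1 / (ε / 2))).finite_cover_balls
    (show 0 < ε / 8 by positivity)
  have hev : ∀ᶠ i in l, ∀ y ∈ t, |F i y - f y| < ε / 8 :=
    (eventually_all_finite ht).2 fun y _ => Metric.tendsto_nhds.1 (h y) _ (by positivity)
  filter_upwards [hev, hF] with i hi hFi
  refine (dist_le_of_forall_abs_le (half_pos hε) fun x hx => ?_).trans_lt (half_lt_self hε)
  obtain ⟨y, hy, hxy⟩ := mem_iUnion₂.1 (hcov (Metric.mem_closedBall.2 hx.le))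
  have h1 := abs_le.1 (hFi x y)
  have h2 := abs_le.1 (hf x y)
  have h3 := abs_lt.1 (hi y hy)
  rw [Metric.mem_ball] at hxy
  exact abs_le.2 ⟨by linarith, by linarith⟩

end PointedContFun

/-! ### The embedding into the compact set of 1-Lipschitz functions -/

section Embedding

variable {X : Type*} [MetricSpace X] {x₀ : X}

theorem busemannEmbedding_apply (p x : X) :
    (busemannEmbedding x₀ p).1 x = dist p x - dist p x₀ := rfl

theorem busemannEmbedding_lipschitz (p x y : X) :
    |(busemannEmbedding x₀ p).1 x - (busemannEmbedding x₀ p).1 y| ≤ dist x y := by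
  simp only [busemannEmbedding_apply, sub_sub_sub_cancel_right]
  rw [dist_comm p x, dist_comm p y]
  exact abs_dist_sub_le x y p

theorem continuous_busemannEmbedding [ProperSpace X] : Continuous (busemannEmbedding x₀) := by
  refine continuous_induced_rng.2 (continuous_iff_continuousAt.2 fun p => ?_)
  refine PointedContFun.tendsto_of_pointwise
    (Eventually.of_forall fun q => busemannEmbedding_lipschitz q) (busemannEmbedding_lipschitz p)
    fun x => ?_
  simp only [Function.comp_apply, busemannEmbedding_apply]
  exact Continuous.tendsto (by fun_prop) p

/-- The `1`-Lipschitz functions vanishing at the base point. -/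
def lipschitzZero (x₀ : X) : Set (contFunZero x₀) :=
  {f | ∀ x y, |f.1 x - f.1 y| ≤ dist x y}

/-- Arzelà–Ascoli: the value at `x` stays in `[-d(x, x₀), d(x, x₀)]`, so every ultrafilter converges
pointwise. The limit is again 1-Lipschitz, and pointwise convergence is then convergence for the
metric. -/
theorem isCompact_lipschitzZero [ProperSpace X] : IsCompact (lipschitzZero x₀) := by
  refine isCompact_iff_ultrafilter_le_nhds.2 fun U hU => ?_
  have hev : ∀ᶠ f in (U : Filter (contFunZero x₀)), f ∈ lipschitzZero x₀ := by simpa using hU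
  have hlim : ∀ x, ∃ a, Tendsto (fun f : contFunZero x₀ => f.1 x) U (𝓝 a) := fun x => by
    obtain ⟨a, -, ha⟩ := (isCompact_Icc (a := -dist x x₀) (b := dist x x₀)).ultrafilter_le_nhds
      (U.map fun f : contFunZero x₀ => f.1 x) (by
        refine le_principal_iff.2 ?_
        refine Filter.mem_map.2 ?_
        filter_upwards [hev] with f hf
        have := hf x x₀
        rw [show f.1 x₀ = 0 from f.2, sub_zero] at this
        exact abs_le.1 this)
    exact ⟨a, ha⟩
  choose F hF using hlim
  have hLip : ∀ x y, |F x - F y| ≤ dist x y := fun x y =>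
    le_of_tendsto ((hF x).sub (hF y)).abs (hev.mono fun f hf => hf x y)
  have hcont : Continuous F :=
    (LipschitzWith.of_dist_le_mul (K := 1) fun x y => by simpa [Real.dist_eq] using hLip x y).continuous
  have h0 : F x₀ = 0 := tendsto_nhds_unique (hF x₀)
    (tendsto_const_nhds.congr fun f => (show f.1 x₀ = 0 from f.2).symm)
  refine ⟨⟨(⟨F, hcont⟩ : C(X, ℝ)), h0⟩, hLip, ?_⟩
  exact tendsto_subtype_rng.2 (PointedContFun.tendsto_of_pointwise hev hLip hF)

theorem closure_range_subset_lipschitzZero [ProperSpace X] :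
    closure (range (busemannEmbedding x₀)) ⊆ lipschitzZero x₀ :=
  closure_minimal (range_subset_iff.2 busemannEmbedding_lipschitz)
    isCompact_lipschitzZero.isClosed

theorem isCompact_closure_range [ProperSpace X] :
    IsCompact (closure (range (busemannEmbedding x₀))) :=
  isCompact_lipschitzZero.of_isClosed_subset isClosed_closure closure_range_subset_lipschitzZero

end Embedding

/-! ### Geometry of CAT(0) spaces -/

section Geometry

variable {X : Type*} [MetricSpace X] {x₀ : X}

/-- Existence of Euclidean comparison triangles, with the two vertices of one side on an axis. -/
theorem exists_comparison_apex {a b c : ℝ} (hD : 0 < a) (h1 : a ≤ b + c)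
    (h2 : b ≤ a + c) (h3 : c ≤ a + b) :
    ∃ u v : ℝ, u ^ 2 + v ^ 2 = b ^ 2 ∧ (a - u) ^ 2 + v ^ 2 = c ^ 2 := by
  set u := (b ^ 2 + a ^ 2 - c ^ 2) / (2 * a) with hu
  have hua : 2 * a * u = b ^ 2 + a ^ 2 - c ^ 2 := by rw [hu]; field_simp
  have hub : u ^ 2 ≤ b ^ 2 := by
    refine sq_le_sq' ?_ ?_
    · rw [hu, le_div_iff₀ (by positivity)]
      nlinarith
    · rw [hu, div_le_iff₀ (by positivity)]
      nlinarith
  refine ⟨u, √(b ^ 2 - u ^ 2), ?_, ?_⟩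
  · rw [Real.sq_sqrt (by linarith)]
    ring
  · rw [Real.sq_sqrt (by linarith)]
    linarith

/-- The CAT(0) inequality in the form of Bruhat and Tits, for all points of a geodesic. -/
theorem IsCAT0.sq_dist_le (h : IsCAT0 X) {x y : X} {γ : ℝ → X} (hγ : IsGeodesicSegment γ x y)
    {l : ℝ} (hl0 : 0 ≤ l) (hl1 : l ≤ 1) (z : X) :
    dist z (γ (l * dist x y)) ^ 2 ≤
      (1 - l) * dist z x ^ 2 + l * dist z y ^ 2 - l * (1 - l) * dist x y ^ 2 := by
  rcases eq_or_ne x y with rfl | hne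
  · simp only [dist_self, mul_zero, hγ.1]
    nlinarith
  have hD : 0 < dist x y := dist_pos.2 hne
  obtain ⟨u, v, h1, h2⟩ := exists_comparison_apex (a := dist x y) (b := dist x z) (c := dist y z)
    hD (dist_comm y z ▸ dist_triangle x z y) (dist_triangle x y z)
    (dist_comm x y ▸ dist_triangle y x z)
  have ht : l * dist x y ∈ Icc 0 (dist x y) := ⟨by positivity, by nlinarith⟩
  have hq : dist x (γ (l * dist x y)) = l * dist x y := by
    have := hγ.2.2 0 ⟨le_rfl, hD.le⟩ _ ht
    rwa [hγ.1, zero_sub, abs_neg, abs_of_nonneg ht.1] at this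
  -- The comparison triangle has its first vertex at the origin, the second on the first axis and
  -- the third at `(u, v)`.
  have hle := h.comparison x y z γ hγ !₂[0, 0] !₂[dist x y, 0] !₂[u, v]
    (by simp [EuclideanSpace.dist_eq, Real.dist_eq])
    (by simp [EuclideanSpace.dist_eq, Real.dist_eq, sq_abs, h1])
    (by simp [EuclideanSpace.dist_eq, Real.dist_eq, sq_abs, h2])
    _ ht !₂[l * dist x y, 0]
    (by
      refine ⟨1 - l, l, by linarith, hl0, by ring, ?_⟩
      ext i
      fin_cases i <;> simp)
    (by simp [EuclideanSpace.dist_eq, Real.sqrt_sq_eq_abs, Real.dist_eq, hq, abs_of_nonneg hl0])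
  have hsq := pow_le_pow_left₀ dist_nonneg hle 2
  have hE : dist (!₂[u, v] : EuclideanSpace ℝ (Fin 2)) !₂[l * dist x y, 0] ^ 2 =
      (u - l * dist x y) ^ 2 + v ^ 2 := by
    rw [EuclideanSpace.dist_eq, Real.sq_sqrt (by positivity)]
    simp [Real.dist_eq, sq_abs]
  rw [hE] at hsq
  rw [dist_comm z x, dist_comm z y]
  nlinarith

/-- Points that divide two sides of a CAT(0) triangle in the same proportion. -/
theorem dist_le_mul_of_sq_dist_le {p x y a b : X} {l : ℝ} (hl0 : 0 ≤ l) (hl1 : l ≤ 1)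
    (ha : ∀ z, dist z a ^ 2 ≤
      (1 - l) * dist z p ^ 2 + l * dist z x ^ 2 - l * (1 - l) * dist p x ^ 2)
    (hb : ∀ z, dist z b ^ 2 ≤
      (1 - l) * dist z p ^ 2 + l * dist z y ^ 2 - l * (1 - l) * dist p y ^ 2) :
    dist a b ≤ l * dist x y := by
  have h1 := ha b
  have h2 := hb x
  have h3 := hb p
  rw [dist_self] at h3
  rw [dist_comm b p, dist_comm b x, dist_comm b a] at h1
  rw [dist_comm x p] at h2
  -- Inserting the bounds for `d(x, b)²` and `d(p, b)²` in the one for `d(a, b)²` cancels everything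
  -- except `l² d(x, y)²`.
  have h4 := mul_le_mul_of_nonneg_left h2 hl0
  have h5 := mul_le_mul_of_nonneg_left h3 (sub_nonneg.2 hl1)
  exact abs_le_of_sq_le_sq' (by nlinarith) (by positivity) |>.2

namespace GeodesicRay

theorem dist_eq (c : GeodesicRay X) (s t : NNReal) :
    dist (c.toFun s) (c.toFun t) = |(s : ℝ) - t| := by
  rw [c.isometry.dist_eq, NNReal.dist_eq]

theorem dist_zero (c : GeodesicRay X) (t : NNReal) : dist (c.toFun 0) (c.toFun t) = t := by
  simp [c.dist_eq]

theorem isGeodesicSegment (c : GeodesicRay X) (t : NNReal) :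
    IsGeodesicSegment (fun s => c.toFun s.toNNReal) (c.toFun 0) (c.toFun t) := by
  refine ⟨by simp, by simp [c.dist_zero], fun r hr s hs => ?_⟩
  rw [c.dist_eq, Real.coe_toNNReal _ hr.1, Real.coe_toNNReal _ hs.1]

theorem sq_dist_le (c : GeodesicRay X) (h : IsCAT0 X) {s t : NNReal} (hst : s ≤ t) (ht : 0 < t)
    (z : X) : dist z (c.toFun s) ^ 2 ≤ (1 - s / t : ℝ) * dist z (c.toFun 0) ^ 2 +
      (s / t : ℝ) * dist z (c.toFun t) ^ 2 -
        (s / t : ℝ) * (1 - s / t) * dist (c.toFun 0) (c.toFun t) ^ 2 := by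
  have ht' : (0 : ℝ) < t := ht
  have := h.sq_dist_le (c.isGeodesicSegment t) (l := s / t) (by positivity)
    ((div_le_one ht').2 hst) z
  simpa [c.dist_zero, div_mul_cancel₀ _ ht'.ne'] using this

/-- Asymptotic rays with the same origin coincide. -/
theorem eq_of_asymptotic (h : IsCAT0 X) {c c' : GeodesicRay X} (h0 : c.toFun 0 = c'.toFun 0)
    {K : ℝ} (hK : ∀ t, dist (c.toFun t) (c'.toFun t) ≤ K) : c = c' := by
  suffices hs : ∀ s, c.toFun s = c'.toFun s by
    cases c
    cases c'
    congr
    exact funext hs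
  intro s
  have hle : ∀ᶠ t : NNReal in atTop, dist (c.toFun s) (c'.toFun s) ≤ s / t * K := by
    filter_upwards [eventually_ge_atTop s, eventually_gt_atTop 0] with t hst ht
    have ht' : (0 : ℝ) < t := ht
    have hl0 : (0 : ℝ) ≤ s / t := by positivity
    have h' := c'.sq_dist_le h hst ht
    rw [← h0] at h'
    exact (dist_le_mul_of_sq_dist_le hl0 ((div_le_one ht').2 hst)
      (c.sq_dist_le h hst ht) h').trans (mul_le_mul_of_nonneg_left (hK t) hl0)
  have hlim : Tendsto (fun t : NNReal => (s / t * K : ℝ)) atTop (𝓝 0) := by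
    have := (Tendsto.const_div_atTop (NNReal.tendsto_coe_atTop.2 tendsto_id) (s : ℝ)).mul_const K
    simpa using this
  exact dist_le_zero.1 (ge_of_tendsto hlim hle)

/-- Rays with the same origin and the same Busemann function coincide. -/
theorem eq_of_tendsto (h : IsCAT0 X) {c c' : GeodesicRay X} (hc : c.toFun 0 = x₀)
    (hc' : c'.toFun 0 = x₀) {f : X → ℝ}
    (hf : ∀ x, Tendsto (fun t => dist x (c.toFun t) - dist x₀ (c.toFun t)) atTop (𝓝 (f x)))
    (hf' : ∀ x, Tendsto (fun t => dist x (c'.toFun t) - dist x₀ (c'.toFun t)) atTop (𝓝 (f x))) :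
    c = c' := by
  have key : ∀ (d : GeodesicRay X), d.toFun 0 = x₀ →
      (∀ x, Tendsto (fun t => dist x (d.toFun t) - dist x₀ (d.toFun t)) atTop (𝓝 (f x))) →
      ∀ s, f (d.toFun s) = -s := fun d hd hfd s => by
    refine tendsto_nhds_unique (hfd _) (tendsto_const_nhds.congr' ?_)
    filter_upwards [eventually_ge_atTop s] with t hst
    rw [← hd, d.dist_zero, d.dist_eq, abs_sub_comm, abs_of_nonneg (sub_nonneg.2 (by simpa))]
    ring
  suffices hs : ∀ s, c.toFun s = c'.toFun s by
    cases c
    cases c'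
    congr
    exact funext hs
  intro s
  obtain ⟨γ, hγ⟩ := h.geodesic (c.toFun s) (c'.toFun s)
  -- If the two points differed, their midpoint `m` would be at distance less than `s` from `x₀`.
  -- But `f m ≤ -s`, since `m` is no farther from `c t` than the farther endpoint, while `f m ≥
  -- -d(m, x₀)`.
  set m := γ (1 / 2 * dist (c.toFun s) (c'.toFun s)) with hm
  have hCN := fun z => h.sq_dist_le hγ (l := 1 / 2) (by norm_num) (by norm_num) z
  rw [← hm] at hCN
  have hfar : ∀ t, dist m (c.toFun t) ≤
      max (dist (c.toFun s) (c.toFun t)) (dist (c'.toFun s) (c.toFun t)) := fun t => by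
    have h1 := hCN (c.toFun t)
    rw [dist_comm _ m, dist_comm _ (c.toFun s), dist_comm _ (c'.toFun s)] at h1
    have h2 := pow_le_pow_left₀ dist_nonneg
      (le_max_left (dist (c.toFun s) (c.toFun t)) (dist (c'.toFun s) (c.toFun t))) 2
    have h3 := pow_le_pow_left₀ dist_nonneg
      (le_max_right (dist (c.toFun s) (c.toFun t)) (dist (c'.toFun s) (c.toFun t))) 2
    have h4 := sq_nonneg (dist (c.toFun s) (c'.toFun s))
    exact abs_le_of_sq_le_sq' (by nlinarith)
      (dist_nonneg.trans (le_max_left _ _)) |>.2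
  have hfm : f m ≤ -s := by
    have hmax := (hf (c.toFun s)).max (hf (c'.toFun s))
    rw [key c hc hf s, key c' hc' hf' s, max_self] at hmax
    refine le_of_tendsto_of_tendsto' (hf m) hmax fun t => ?_
    rw [max_sub_sub_right]
    exact sub_le_sub_right (hfar t) _
  have hge : -dist m x₀ ≤ f m := by
    refine ge_of_tendsto' (hf m) fun t => ?_
    have := dist_triangle x₀ m (c.toFun t)
    rw [dist_comm x₀ m] at this
    linarith
  have h0 := hCN x₀
  have e1 := c.dist_zero s
  have e2 := c'.dist_zero s
  rw [hc] at e1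
  rw [hc'] at e2
  rw [e1, e2, dist_comm] at h0
  have hs0 : (0 : ℝ) ≤ s := s.2
  have hsq : (s : ℝ) ^ 2 ≤ dist m x₀ ^ 2 := pow_le_pow_left₀ hs0 (by linarith) 2
  exact dist_eq_zero.1 (pow_eq_zero_iff two_ne_zero |>.1
    (le_antisymm (by linarith) (sq_nonneg _)))

end GeodesicRay

/-- Geodesics from `x₀` to points escaping to infinity accumulate at a geodesic ray. -/
theorem exists_limit_ray [ProperSpace X] {ι : Type*} {U : Ultrafilter ι} {p : ι → X}
    (hp : Tendsto (fun i => dist x₀ (p i)) U atTop) {σ : ι → ℝ → X}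
    (hσ : ∀ i, IsGeodesicSegment (σ i) x₀ (p i)) :
    ∃ c : GeodesicRay X, c.toFun 0 = x₀ ∧
      ∀ t : NNReal, Tendsto (fun i => σ i t) U (𝓝 (c.toFun t)) := by
  have hlim : ∀ t : NNReal, ∃ a, Tendsto (fun i => σ i t) U (𝓝 a) := fun t => by
    obtain ⟨a, -, ha⟩ := (isCompact_closedBall x₀ (t : ℝ)).ultrafilter_le_nhds
      (U.map fun i => σ i t) (by
        refine le_principal_iff.2 (Filter.mem_map.2 ?_)
        filter_upwards [hp.eventually_ge_atTop (t : ℝ)] with i hi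
        have h := (hσ i).2.2 t ⟨t.2, hi⟩ 0 ⟨le_rfl, dist_nonneg⟩
        rw [(hσ i).1, sub_zero, abs_of_nonneg t.coe_nonneg] at h
        exact h.le)
    exact ⟨a, ha⟩
  choose c hc using hlim
  refine ⟨⟨c, Isometry.of_dist_eq fun s t => ?_⟩, ?_, hc⟩
  · refine tendsto_nhds_unique ((hc s).dist (hc t)) (tendsto_const_nhds.congr' ?_)
    filter_upwards [hp.eventually_ge_atTop (s : ℝ), hp.eventually_ge_atTop (t : ℝ)] with i hs ht
    rw [(hσ i).2.2 s ⟨s.2, hs⟩ t ⟨t.2, ht⟩, NNReal.dist_eq]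
  · refine tendsto_nhds_unique (hc 0) (tendsto_const_nhds.congr fun i => ?_)
    exact (hσ i).1.symm

/-- A criterion for `f` to be the Busemann function of the ray `c`. -/
theorem tendsto_busemann {c : GeodesicRay X} (hc : c.toFun 0 = x₀) {f : X → ℝ}
    (hLip : ∀ x y, |f x - f y| ≤ dist x y) (hf : ∀ t, f (c.toFun t) = -t)
    (hcmp : ∀ x (t : NNReal), dist x (c.toFun t) ^ 2 ≤ t ^ 2 + 2 * t * f x + dist x x₀ ^ 2)
    (x : X) : Tendsto (fun t => dist x (c.toFun t) - dist x₀ (c.toFun t)) atTop (𝓝 (f x)) := by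
  have hd : ∀ t, dist x₀ (c.toFun t) = t := fun t => hc ▸ c.dist_zero t
  simp only [hd]
  -- With `a = t + f x`, the comparison hypothesis gives `d(x, c t)² ≤ a² + d(x, x₀)²`, and `√(a² +
  -- r²) ≤ a + r²/(2a)`. The lower bound is the Lipschitz property.
  have hup : Tendsto (fun t : NNReal => f x + dist x x₀ ^ 2 / (2 * (t + f x))) atTop
      (𝓝 (f x + 0)) := by
    refine tendsto_const_nhds.add (Tendsto.const_div_atTop ?_ _)
    exact (tendsto_atTop_add_const_right _ _
      (NNReal.tendsto_coe_atTop.2 tendsto_id)).const_mul_atTop two_pos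
  rw [add_zero] at hup
  refine tendsto_of_tendsto_of_tendsto_of_le_of_le' tendsto_const_nhds hup
    (Eventually.of_forall fun t => ?_) ?_
  · have := (abs_le.1 (hLip x (c.toFun t))).2
    rw [hf] at this
    linarith
  · filter_upwards [(NNReal.tendsto_coe_atTop.2 tendsto_id).eventually_gt_atTop (-f x)] with t ht
    have ha : 0 < (t : ℝ) + f x := by
      simp only [id_eq] at ht
      linarith
    have h1 := hcmp x t
    set a := (t : ℝ) + f x with haa
    set e := dist x x₀ ^ 2 / (2 * a) with he
    have he0 : 0 ≤ e := by positivity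
    have hae : 2 * a * e = dist x x₀ ^ 2 := by rw [he]; field_simp
    have : dist x (c.toFun t) ≤ a + e :=
      abs_le_of_sq_le_sq' (by nlinarith [sq_nonneg (f x), sq_nonneg e]) (by positivity) |>.2
    linarith

/-- Comparison of a Busemann function with the distance from a point of a geodesic from `x₀`. -/
theorem IsCAT0.sq_dist_geodesic_le (h : IsCAT0 X) {p : X} {γ : ℝ → X}
    (hγ : IsGeodesicSegment γ x₀ p) {t : ℝ} (ht0 : 0 ≤ t) (htp : t ≤ dist x₀ p)
    (hp : 0 < dist x₀ p) (x : X) :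
    dist x (γ t) ^ 2 ≤ t ^ 2 + 2 * t * (dist p x - dist p x₀) + dist x x₀ ^ 2 := by
  have h1 := h.sq_dist_le hγ (l := t / dist x₀ p) (by positivity) ((div_le_one hp).2 htp) x
  rw [div_mul_cancel₀ _ hp.ne'] at h1
  have hl0 : 0 ≤ t / dist x₀ p := by positivity
  have hl1 : t / dist x₀ p ≤ 1 := (div_le_one hp).2 htp
  have hl : t / dist x₀ p * dist x₀ p = t := div_mul_cancel₀ _ hp.ne'
  set l := t / dist x₀ p
  -- Writing `d(x, p) = d(x₀, p) + q`, the right side of `h1` becomes `(1 - l) d(x, x₀)² + l q² +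
  -- 2tq + t²`, so `q² ≤ d(x, x₀)²` suffices.
  have hq : (dist x p - dist x₀ p) ^ 2 ≤ dist x x₀ ^ 2 :=
    sq_le_sq.2 ((abs_dist_sub_le x x₀ p).trans (le_abs_self _))
  have hlq := mul_le_mul_of_nonneg_left hq hl0
  rw [dist_comm p x, dist_comm p x₀]
  generalize dist x (γ t) = e at h1
  rw [← hl]
  linarith

/-- A limit of images of points escaping to infinity is a Busemann function. -/
theorem mem_boundarySet_of_tendsto [ProperSpace X] (h : IsCAT0 X) {ι : Type*} {U : Ultrafilter ι}
    {p : ι → X} (hp : Tendsto (fun i => dist x₀ (p i)) U atTop) {f : contFunZero x₀}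
    (hf : Tendsto (fun i => busemannEmbedding x₀ (p i)) U (𝓝 f)) : f ∈ boundarySet x₀ := by
  choose σ hσ using fun i => h.geodesic x₀ (p i)
  obtain ⟨c, hc0, hc⟩ := exists_limit_ray hp hσ
  have hpt : ∀ x, Tendsto (fun i => dist (p i) x - dist (p i) x₀) U (𝓝 (f.1 x)) := fun x =>
    ((PointedContFun.continuous_eval x).tendsto _).comp ((continuous_subtype_val.tendsto _).comp hf)
  have hLip : ∀ x y, |f.1 x - f.1 y| ≤ dist x y :=
    closure_range_subset_lipschitzZero
      (mem_closure_of_tendsto hf (Eventually.of_forall fun i => mem_range_self _))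
  refine ⟨Quotient.mk _ c, c, hc0, rfl, tendsto_busemann hc0 hLip (fun t => ?_) fun x t => ?_⟩
  -- The image of `p i` takes the value `-t` at `σ i t`, and the uniform Lipschitz bound permits
  -- replacing `σ i t` by its limit `c t`.
  · have h1 : Tendsto (fun i => dist (p i) (σ i t) - dist (p i) x₀) U (𝓝 (f.1 (c.toFun t))) := by
      have h2 : Tendsto (fun i => (dist (p i) (σ i t) - dist (p i) x₀) -
          (dist (p i) (c.toFun t) - dist (p i) x₀)) U (𝓝 0) := by
        refine squeeze_zero_norm (fun i => ?_) (tendsto_iff_dist_tendsto_zero.1 (hc t))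
        exact busemannEmbedding_lipschitz (x₀ := x₀) (p i) (σ i t) (c.toFun t)
      simpa using h2.add (hpt (c.toFun t))
    refine tendsto_nhds_unique h1 (tendsto_const_nhds.congr' ?_)
    filter_upwards [hp.eventually_ge_atTop (t : ℝ)] with i hi
    have h3 := (hσ i).2.2 _ ⟨dist_nonneg, le_rfl⟩ t ⟨t.2, hi⟩
    rw [(hσ i).2.1, abs_of_nonneg (sub_nonneg.2 hi)] at h3
    rw [h3, dist_comm (p i)]
    ring
  · refine le_of_tendsto_of_tendsto ((tendsto_const_nhds.dist (hc t)).pow 2)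
      ((tendsto_const_nhds.add ((hpt x).const_mul _)).add_const _) ?_
    filter_upwards [hp.eventually_ge_atTop (t : ℝ), hp.eventually_gt_atTop 0] with i hi hi0
    exact h.sq_dist_geodesic_le (hσ i) t.2 hi hi0 x

/-- Busemann functions are the limits of the images of points escaping to infinity. -/
theorem mem_boundarySet_iff [ProperSpace X] (h : IsCAT0 X) {f : contFunZero x₀} :
    f ∈ boundarySet x₀ ↔
      ∀ R : ℝ, ∀ ε > 0, ∃ p, R < dist p x₀ ∧ dist (busemannEmbedding x₀ p) f < ε := by
  constructor
  · rintro ⟨ξ, c, hc0, -, hc⟩ R ε hε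
    have hc' : ∀ x, Tendsto (fun t => (busemannEmbedding x₀ (c.toFun t)).1 x) atTop (𝓝 (f.1 x)) :=
      fun x => (hc x).congr fun t => by
        rw [busemannEmbedding_apply, dist_comm x, dist_comm x₀]
    have hLip : ∀ x y, |f.1 x - f.1 y| ≤ dist x y := fun x y =>
      le_of_tendsto ((hc' x).sub (hc' y)).abs
        (Eventually.of_forall fun t => busemannEmbedding_lipschitz _ x y)
    have hlim : Tendsto (fun t => busemannEmbedding x₀ (c.toFun t)) atTop (𝓝 f) :=
      tendsto_subtype_rng.2 (PointedContFun.tendsto_of_pointwise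
        (Eventually.of_forall fun t => busemannEmbedding_lipschitz _) hLip hc')
    obtain ⟨t, ht, htR⟩ := ((Metric.tendsto_nhds.1 hlim ε hε).and
      ((NNReal.tendsto_coe_atTop.2 tendsto_id).eventually_gt_atTop R)).exists
    refine ⟨c.toFun t, ?_, ht⟩
    rwa [dist_comm, ← hc0, c.dist_zero]
  · intro hf
    choose p hpR hpf using fun n : ℕ => hf n (1 / (n + 1 : ℝ)) Nat.one_div_pos_of_nat
    refine mem_boundarySet_of_tendsto h (U := Ultrafilter.of atTop) (p := p) ?_ ?_
    · refine Tendsto.mono_left ?_ (Ultrafilter.of_le _)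
      refine tendsto_atTop_mono (fun n => ?_) tendsto_natCast_atTop_atTop
      rw [dist_comm]
      exact (hpR n).le
    · refine Tendsto.mono_left ?_ (Ultrafilter.of_le _)
      refine tendsto_iff_dist_tendsto_zero.2 (squeeze_zero (fun _ => dist_nonneg)
        (fun n => (hpf n).le) tendsto_one_div_add_atTop_nhds_zero_nat)

/-- The approximation criterion `mem_boundarySet_iff` tolerates an arbitrarily small error in `f`,
hence passes to limits. -/
theorem isClosed_boundarySet [ProperSpace X] (h : IsCAT0 X) : IsClosed (boundarySet x₀) := by
  refine isClosed_of_closure_subset fun f hf => (mem_boundarySet_iff h).2 fun R ε hε => ?_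
  obtain ⟨g, hg, hfg⟩ := Metric.mem_closure_iff.1 hf _ (half_pos hε)
  obtain ⟨p, hp, hpg⟩ := (mem_boundarySet_iff h).1 hg R _ (half_pos hε)
  refine ⟨p, hp, ?_⟩
  rw [dist_comm] at hfg
  linarith [dist_triangle (busemannEmbedding x₀ p) g f]

theorem boundarySet_subset_closure_range [ProperSpace X] (h : IsCAT0 X) :
    boundarySet x₀ ⊆ closure (range (busemannEmbedding x₀)) := fun f hf => by
  refine Metric.mem_closure_iff.2 fun ε hε => ?_
  obtain ⟨p, -, hp⟩ := (mem_boundarySet_iff h).1 hf 0 ε hε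
  exact ⟨_, mem_range_self p, by rwa [dist_comm]⟩

/-- Every asymptoty class contains a ray from `x₀`. -/
theorem exists_asymptotic_ray [ProperSpace X] (h : IsCAT0 X) (x₀ : X) (c : GeodesicRay X) :
    ∃ c' : GeodesicRay X, c'.toFun 0 = x₀ ∧
      ∀ t, dist (c'.toFun t) (c.toFun t) ≤ 2 * dist x₀ (c.toFun 0) := by
  set K := dist x₀ (c.toFun 0) with hK
  set U : Ultrafilter NNReal := Ultrafilter.of atTop
  have hUle : (U : Filter NNReal) ≤ atTop := Ultrafilter.of_le _
  choose σ hσ using fun n => h.geodesic x₀ (c.toFun n)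
  have hn : ∀ n : NNReal, |dist x₀ (c.toFun n) - n| ≤ K := fun n => by
    have := abs_dist_sub_le x₀ (c.toFun 0) (c.toFun n)
    rwa [c.dist_zero] at this
  have hp : Tendsto (fun n => dist x₀ (c.toFun n)) (U : Filter NNReal) atTop := by
    refine Tendsto.mono_left ?_ hUle
    refine tendsto_atTop_mono (fun n => ?_)
      (tendsto_atTop_add_const_right _ (-K) (NNReal.tendsto_coe_atTop.2 tendsto_id))
    have := (abs_le.1 (hn n)).1
    simp only [id_eq]
    linarith
  obtain ⟨c', hc0, hc⟩ := exists_limit_ray hp hσ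
  refine ⟨c', hc0, fun t => ?_⟩
  refine le_of_tendsto ((hc t).dist tendsto_const_nhds) ?_
  filter_upwards [hp.eventually_ge_atTop (t : ℝ), hp.eventually_gt_atTop 0,
    hUle (eventually_gt_atTop 0)] with n hDt hD hn0
  set D := dist x₀ (c.toFun n) with hDdef
  have hn0' : (0 : ℝ) < n := hn0
  have hl0 : (0 : ℝ) ≤ t / D := by positivity
  have hl1 : (t : ℝ) / D ≤ 1 := (div_le_one hD).2 hDt
  have ha := fun z => h.sq_dist_le (hσ n) hl0 hl1 z
  have hb := fun z => h.sq_dist_le (c.isGeodesicSegment n) hl0 hl1 z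
  rw [← hDdef, div_mul_cancel₀ _ hD.ne'] at ha
  rw [c.dist_zero] at hb
  -- The intermediate point on `c` is at the proportion `t / D` from its origin. Seen from the
  -- common apex `c n`, both points are at proportion `1 - t / D`, which bounds this distance; the
  -- shift along `c` costs at most `(t / D) K`.
  have h1 : dist (σ n t) (c.toFun (t / D * n : ℝ).toNNReal) ≤ (1 - t / D) * K := by
    refine dist_le_mul_of_sq_dist_le (p := c.toFun n) (by linarith) (by linarith) (fun z => ?_)
      fun z => ?_
    · have := ha z
      rw [dist_comm (c.toFun n) x₀, ← hDdef]
      linarith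
    · have := hb z
      rw [dist_comm (c.toFun n) (c.toFun 0), c.dist_zero]
      linarith
  have h2 : dist (c.toFun (t / D * n : ℝ).toNNReal) (c.toFun t) ≤ (t / D) * K := by
    rw [c.dist_eq, Real.coe_toNNReal _ (by positivity)]
    have : (t : ℝ) / D * n - t = (t / D) * -(D - n) := by field_simp; ring
    rw [this, abs_mul, abs_neg, abs_of_nonneg hl0]
    exact mul_le_mul_of_nonneg_left (hn n) hl0
  have hK0 : 0 ≤ K := dist_nonneg
  linarith [dist_triangle (σ n t) (c.toFun (t / D * n : ℝ).toNNReal) (c.toFun t)]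

/-- The Busemann function of a ray from `x₀` exists. -/
theorem exists_tendsto_busemann (c : GeodesicRay X) (hc : c.toFun 0 = x₀) :
    ∃ f : contFunZero x₀, ∀ x,
      Tendsto (fun t => dist x (c.toFun t) - dist x₀ (c.toFun t)) atTop (𝓝 (f.1 x)) := by
  have hd : ∀ t, dist x₀ (c.toFun t) = t := fun t => hc ▸ c.dist_zero t
  have hlim : ∀ x, ∃ a, Tendsto (fun t => dist x (c.toFun t) - dist x₀ (c.toFun t)) atTop (𝓝 a) :=
    fun x => by
      -- By the triangle inequality the expression is nonincreasing in `t` and bounded below by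
      -- `-d(x, x₀)`.
      refine ⟨_, tendsto_atTop_ciInf (fun s t hst => ?_) ⟨-dist x x₀, ?_⟩⟩
      · have h1 := dist_triangle x (c.toFun s) (c.toFun t)
        have h2 : (s : ℝ) ≤ t := hst
        rw [c.dist_eq, abs_sub_comm, abs_of_nonneg (sub_nonneg.2 h2)] at h1
        simp only [hd]
        linarith
      · rintro _ ⟨t, rfl⟩
        have := dist_triangle x₀ x (c.toFun t)
        rw [dist_comm x₀ x] at this
        simp only
        linarith
  choose f hf using hlim
  have hLip : ∀ x y, |f x - f y| ≤ dist x y := fun x y => by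
    refine le_of_tendsto ((hf x).sub (hf y)).abs (Eventually.of_forall fun t => ?_)
    rw [sub_sub_sub_cancel_right]
    exact abs_dist_sub_le x y _
  have hcont : Continuous f :=
    (LipschitzWith.of_dist_le_mul (K := 1) fun x y => by
      simpa [Real.dist_eq] using hLip x y).continuous
  have h0 : f x₀ = 0 :=
    tendsto_nhds_unique (hf x₀) (tendsto_const_nhds.congr fun t => (sub_self _).symm)
  exact ⟨⟨(⟨f, hcont⟩ : C(X, ℝ)), h0⟩, hf⟩

theorem existsUnique_isBusemannFunction [ProperSpace X] (h : IsCAT0 X) (ξ : VisualBoundary X) :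
    ∃! f : contFunZero x₀, IsBusemannFunction x₀ ξ f.1 := by
  obtain ⟨c, rfl⟩ := Quotient.exists_rep ξ
  obtain ⟨c', h0, hc'⟩ := exists_asymptotic_ray h x₀ c
  have hcls : Quotient.mk (asymptoticSetoid X) c' = Quotient.mk _ c := Quotient.sound ⟨_, hc'⟩
  obtain ⟨f, hf⟩ := exists_tendsto_busemann c' h0
  refine ⟨f, ⟨c', h0, hcls, hf⟩, fun g ⟨d, hd0, hdcls, hg⟩ => ?_⟩
  obtain ⟨K, hK⟩ := Quotient.exact (hdcls.trans hcls.symm)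
  obtain rfl := GeodesicRay.eq_of_asymptotic h (hd0.trans h0.symm) hK
  exact Subtype.ext (DFunLike.ext _ _ fun x => tendsto_nhds_unique (hg x) (hf x))

theorem eq_of_isBusemannFunction (h : IsCAT0 X) {ξ η : VisualBoundary X} {f : X → ℝ}
    (hξ : IsBusemannFunction x₀ ξ f) (hη : IsBusemannFunction x₀ η f) : ξ = η := by
  obtain ⟨c, hc0, rfl, hc⟩ := hξ
  obtain ⟨c', hc0', rfl, hc'⟩ := hη
  rw [GeodesicRay.eq_of_tendsto h hc0 hc0' hc hc']

end Geometry

/-! ### Borel structures -/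

section Borel

variable {Ω : Type*} [MeasurableSpace Ω] {X : Ω → Type*} [∀ ω, MetricSpace (X ω)]
  {L : Set (∀ ω, X ω)} {A : ∀ ω, Set (X ω)}

/-- The distance is less than `a` exactly when some detour through a `D n` is shorter than `a`, a
countable union. -/
theorem measurable_dist_of_dense {x y : ∀ ω, X ω} {D : ℕ → ∀ ω, X ω}
    (hx : ∀ n, Measurable fun ω => dist (x ω) (D n ω))
    (hy : ∀ n, Measurable fun ω => dist (D n ω) (y ω))
    (hD : ∀ ω, y ω ∈ closure (range fun n => D n ω)) :
    Measurable fun ω => dist (x ω) (y ω) := by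
  refine measurable_of_Iio fun a => ?_
  have : (fun ω => dist (x ω) (y ω)) ⁻¹' Iio a =
      ⋃ n, {ω | dist (x ω) (D n ω) + dist (D n ω) (y ω) < a} := by
    ext ω
    simp only [mem_preimage, mem_Iio, mem_iUnion, mem_ofPred_eq]
    constructor
    · intro h
      obtain ⟨_, ⟨n, rfl⟩, hn⟩ := Metric.mem_closure_iff.1 (hD ω) _ (half_pos (sub_pos.2 h))
      refine ⟨n, ?_⟩
      have := dist_triangle (x ω) (y ω) (D n ω)
      simp only at hn
      rw [dist_comm (D n ω)]
      linarith
    · rintro ⟨n, hn⟩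
      exact (dist_triangle _ _ _).trans_lt hn
  rw [this]
  exact MeasurableSet.iUnion fun n => measurableSet_lt ((hx n).add (hy n)) measurable_const

namespace IsBorelStructure

/-- Maximality need only be tested on a sequence of Borel sections that accumulates at `y`. -/
theorem mem_of_dense (hL : IsBorelStructure L) {y : ∀ ω, X ω} {D : ℕ → ∀ ω, X ω}
    (hDL : ∀ n, D n ∈ L) (hy : ∀ n, Measurable fun ω => dist (D n ω) (y ω))
    (hD : ∀ ω, y ω ∈ closure (range fun n => D n ω)) : y ∈ L :=
  hL.maximal y fun x hx => measurable_dist_of_dense (fun n => hL.compatible x hx _ (hDL n)) hy hD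

theorem mem_of_tendsto (hL : IsBorelStructure L) {y : ∀ ω, X ω} {u : ℕ → ∀ ω, X ω}
    (hu : ∀ n, u n ∈ L) (hlim : ∀ ω, Tendsto (fun n => u n ω) atTop (𝓝 (y ω))) : y ∈ L :=
  hL.maximal y fun x hx => measurable_of_tendsto_metrizable
    (fun n => hL.compatible x hx _ (hu n))
    (tendsto_pi_nhds.2 fun ω => tendsto_const_nhds.dist (hlim ω))

/-- On each measurable piece `N = n` the distance functions are those of `D n`; this makes
measurable choices of an index legitimate. -/
theorem glue_mem (hL : IsBorelStructure L) {D : ℕ → ∀ ω, X ω} (hD : ∀ n, D n ∈ L) {N : Ω → ℕ}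
    (hN : Measurable N) : (fun ω => D (N ω) ω) ∈ L :=
  hL.maximal _ fun x hx =>
    (measurable_from_prod_countable_left (f := fun q : Ω × ℕ => dist (x q.1) (D q.2 q.1))
      fun n => hL.compatible x hx _ (hD n)).comp (measurable_id.prodMk hN)

theorem inherited (hL : IsBorelStructure L) (hA : IsBorelSubfield L A)
    (hne : ∀ ω, (A ω).Nonempty) : IsBorelStructure (inheritedStructure L A) := by
  obtain ⟨-, D, hDL, hD⟩ := hA
  refine ⟨fun x hx y hy => hL.compatible _ hx _ hy, fun y hy => ?_, ?_⟩
  · exact hL.mem_of_dense (y := fun ω => (y ω : X ω)) hDL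
      (fun n => hy (fun ω => ⟨D n ω, (hD ω (hne ω)).1 n⟩) (hDL n))
      fun ω => (hD ω (hne ω)).2 (y ω).2
  · refine ⟨fun n ω => ⟨D n ω, (hD ω (hne ω)).1 n⟩, hDL, fun ω => eq_univ_of_forall fun a => ?_⟩
    refine Metric.mem_closure_iff.2 fun ε hε => ?_
    obtain ⟨_, ⟨n, rfl⟩, hn⟩ := Metric.mem_closure_iff.1 ((hD ω (hne ω)).2 a.2) ε hε
    exact ⟨_, ⟨n, rfl⟩, hn⟩

/-- A Borel section that is closer to `A`, and not much further from a given section than `A` is. -/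
theorem exists_section_step (hL : IsBorelStructure L) (hne : ∀ ω, (A ω).Nonempty)
    (hm : ∀ x ∈ L, Measurable fun ω => Metric.infDist (x ω) (A ω)) {y : ∀ ω, X ω} (hy : y ∈ L)
    {δ : ℝ} (hδ : 0 < δ) : ∃ y' ∈ L, ∀ ω, Metric.infDist (y' ω) (A ω) < δ ∧
      dist (y ω) (y' ω) < Metric.infDist (y ω) (A ω) + δ := by
  classical
  obtain ⟨D, hDL, hD⟩ := hL.separable
  have hex : ∀ ω, ∃ n, Metric.infDist (D n ω) (A ω) < δ ∧
      dist (y ω) (D n ω) < Metric.infDist (y ω) (A ω) + δ := fun ω => by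
    obtain ⟨a, ha, hya⟩ := (Metric.infDist_lt_iff (hne ω)).1
      (lt_add_of_pos_right (Metric.infDist (y ω) (A ω)) (half_pos hδ))
    obtain ⟨_, ⟨n, rfl⟩, hn⟩ := Metric.mem_closure_iff.1
      (show a ∈ closure (range fun n => D n ω) from hD ω ▸ mem_univ a) _ (half_pos hδ)
    simp only at hn
    refine ⟨n, ?_, ?_⟩
    · refine (Metric.infDist_le_dist_of_mem ha).trans_lt ?_
      rw [dist_comm]
      linarith
    · linarith [dist_triangle (y ω) a (D n ω)]
  -- The least admissible index depends measurably on `ω`.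
  refine ⟨fun ω => D (Nat.find (hex ω)) ω, hL.glue_mem hDL (measurable_find hex fun n => ?_),
    fun ω => Nat.find_spec (hex ω)⟩
  exact (measurableSet_lt (hm _ (hDL n)) measurable_const).inter
    (measurableSet_lt (hL.compatible _ hy _ (hDL n)) ((hm _ hy).add_const δ))

/-- A Borel section of `A` that is not much further from a given section than `A` is. -/
theorem exists_section_mem [∀ ω, CompleteSpace (X ω)] (hL : IsBorelStructure L)
    (hcl : ∀ ω, IsClosed (A ω)) (hne : ∀ ω, (A ω).Nonempty)
    (hm : ∀ x ∈ L, Measurable fun ω => Metric.infDist (x ω) (A ω)) {s : ∀ ω, X ω} (hs : s ∈ L)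
    {ε : ℝ} (hε : 0 < ε) : ∃ y ∈ L, ∀ ω, y ω ∈ A ω ∧
      dist (s ω) (y ω) ≤ Metric.infDist (s ω) (A ω) + 5 * ε := by
  choose! step hstepL hstep using fun (y : ∀ ω, X ω) (hy : y ∈ L) (δ : ℝ) (hδ : 0 < δ) =>
    hL.exists_section_step hne hm hy hδ
  -- Steps with tolerances `ε / 2 ^ k` move by at most `2ε / 2 ^ k`, in total `4ε`; the initial step
  -- from `s` adds the last `ε` of `5 * ε`.
  let Z : ℕ → ∀ ω, X ω := fun k => Nat.rec (step s ε) (fun k z => step z (ε / 2 ^ (k + 1))) k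
  have hpos : ∀ k : ℕ, 0 < ε / 2 ^ k := fun k => by positivity
  have hZL : ∀ k, Z k ∈ L := fun k => by
    induction k with
    | zero => exact hstepL s hs ε hε
    | succ k ih => exact hstepL _ ih _ (hpos _)
  have hZA : ∀ k ω, Metric.infDist (Z k ω) (A ω) < ε / 2 ^ k := fun k ω => by
    cases k with
    | zero => simpa [Z] using (hstep s hs ε hε ω).1
    | succ k => exact (hstep _ (hZL k) _ (hpos _) ω).1
  have hZd : ∀ ω k, dist (Z k ω) (Z (k + 1) ω) ≤ 4 * ε / 2 / 2 ^ k := fun ω k => by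
    have h1 := (hstep _ (hZL k) _ (hpos (k + 1)) ω).2
    have h2 := hZA k ω
    have h3 : ε / 2 ^ (k + 1) ≤ ε / 2 ^ k := by
      rw [pow_succ, ← div_div]
      exact half_le_self (hpos k).le
    have h4 : 4 * ε / 2 / 2 ^ k = ε / 2 ^ k + ε / 2 ^ k := by ring
    rw [h4]
    exact h1.le.trans (by linarith)
  choose y hy using fun ω => cauchySeq_tendsto_of_complete (cauchySeq_of_le_geometric_two (hZd ω))
  refine ⟨y, hL.mem_of_tendsto hZL hy, fun ω => ⟨?_, ?_⟩⟩
  · rw [(hcl ω).mem_iff_infDist_zero (hne ω)]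
    have h1 := ((Metric.continuous_infDist_pt (A ω)).tendsto (y ω)).comp (hy ω)
    refine tendsto_nhds_unique h1 (squeeze_zero (fun _ => Metric.infDist_nonneg)
      (fun k => (hZA k ω).le) ?_)
    simpa [div_eq_mul_inv] using
      (tendsto_pow_atTop_nhds_zero_of_lt_one (r := (2⁻¹ : ℝ)) (by norm_num)
        (by norm_num)).const_mul ε
  · have h1 := (hstep s hs ε hε ω).2
    have h2 := dist_le_of_le_geometric_two_of_tendsto₀ (hZd ω) (hy ω)
    have h3 := dist_triangle (s ω) (Z 0 ω) (y ω)
    have h4 : Z 0 ω = step s ε ω := rfl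
    rw [h4] at h2 h3
    linarith

/-- A field of closed subsets with Borel distance functions is a Borel subfield. -/
theorem isBorelSubfield_of_infDist [∀ ω, CompleteSpace (X ω)] (hL : IsBorelStructure L)
    (hcl : ∀ ω, IsClosed (A ω)) (hb : MeasurableSet {ω | (A ω).Nonempty})
    (hm : ∀ x ∈ L, Measurable fun ω => Metric.infDist (x ω) (A ω)) : IsBorelSubfield L A := by
  classical
  obtain ⟨D, hDL, hD⟩ := hL.separable
  -- Off the base `A` is replaced by the whole space. The distance functions do not change, as the
  -- distance to the empty set is `0` by convention.
  let B : ∀ ω, Set (X ω) := fun ω => if (A ω).Nonempty then A ω else univ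
  have hBA : ∀ ω, (A ω).Nonempty → B ω = A ω := fun ω h => if_pos h
  have hBu : ∀ ω, ¬(A ω).Nonempty → B ω = univ := fun ω h => if_neg h
  have hBcl : ∀ ω, IsClosed (B ω) := fun ω => by
    by_cases h : (A ω).Nonempty
    · rw [hBA ω h]; exact hcl ω
    · rw [hBu ω h]; exact isClosed_univ
  have hBne : ∀ ω, (B ω).Nonempty := fun ω => by
    by_cases h : (A ω).Nonempty
    · rwa [hBA ω h]
    · rw [hBu ω h]; exact ⟨D 0 ω, mem_univ _⟩
  have hBd : ∀ ω x, Metric.infDist x (B ω) = Metric.infDist x (A ω) := fun ω x => by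
    by_cases h : (A ω).Nonempty
    · rw [hBA ω h]
    · rw [hBu ω h, not_nonempty_iff_eq_empty.1 h, Metric.infDist_empty,
        Metric.infDist_zero_of_mem (mem_univ x)]
  have hBm : ∀ x ∈ L, Measurable fun ω => Metric.infDist (x ω) (B ω) := fun x hx => by
    simpa only [hBd] using hm x hx
  choose Y hYL hY using fun n k : ℕ =>
    hL.exists_section_mem hBcl hBne hBm (hDL n) (Nat.one_div_pos_of_nat (α := ℝ) (n := k))
  refine ⟨hb, fun m => Y m.unpair.1 m.unpair.2, fun m => hYL _ _, fun ω hω => ⟨fun m => ?_, ?_⟩⟩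
  · exact hBA ω hω ▸ (hY m.unpair.1 m.unpair.2 ω).1
  · refine fun a ha => Metric.mem_closure_iff.2 fun ε hε => ?_
    obtain ⟨_, ⟨n, rfl⟩, hn⟩ := Metric.mem_closure_iff.1
      (show a ∈ closure (range fun n => D n ω) from hD ω ▸ mem_univ a) (ε / 4) (by positivity)
    -- The errors are `ε/4` from `a` to `D n`, and less than `ε/4 + 5 · ε/10` from `D n` to `Y n k`.
    obtain ⟨k, hk⟩ := exists_nat_one_div_lt (show 0 < ε / 10 by positivity)
    refine ⟨_, ⟨Nat.pair n k, rfl⟩, ?_⟩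
    simp only [Nat.unpair_pair]
    have h1 := (hY n k ω).2
    have h2 := Metric.infDist_le_dist_of_mem (x := D n ω) (hBA ω hω ▸ ha)
    simp only at hn
    rw [dist_comm (D n ω) a] at h2
    linarith [dist_triangle a (D n ω) (Y n k ω)]

end IsBorelStructure

theorem IsBorelSubfield.closure (hA : IsBorelSubfield L A) :
    IsBorelSubfield L fun ω => closure (A ω) := by
  obtain ⟨hb, y, hyL, hy⟩ := hA
  simp only [IsBorelSubfield, closure_nonempty_iff]
  exact ⟨hb, y, hyL, fun ω hω => ⟨fun n => subset_closure ((hy ω hω).1 n),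
    closure_minimal (hy ω hω).2 isClosed_closure⟩⟩

theorem IsContinuousBorelMorphism.isBorelSubfield_range {Y : Ω → Type*} [∀ ω, MetricSpace (Y ω)]
    {M : Set (∀ ω, Y ω)} {φ : ∀ ω, X ω → Y ω} (hL : IsBorelStructure L)
    (hφ : IsContinuousBorelMorphism L M φ) : IsBorelSubfield M fun ω => range (φ ω) := by
  obtain ⟨D, hDL, hD⟩ := hL.separable
  refine ⟨?_, fun n ω => φ ω (D n ω), fun n => hφ.1 _ (hDL n), fun ω _ => ⟨fun n => ⟨_, rfl⟩, ?_⟩⟩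
  · convert MeasurableSet.univ
    exact eq_univ_of_forall fun ω => ⟨φ ω (D 0 ω), _, rfl⟩
  · have hd : DenseRange fun n => D n ω := dense_iff_closure_eq.2 (hD ω)
    exact (hφ.2 ω).range_subset_closure_image_dense hd |>.trans
      (closure_mono (by rintro _ ⟨_, ⟨n, rfl⟩, rfl⟩; exact ⟨n, rfl⟩))

end Borel

/-! ### The field of spaces of continuous functions -/

section ContFun

/-- The functions `dist (D k) ·`, as a family of continuous functions. -/
def distFun {X : Type*} [MetricSpace X] (D : ℕ → X) (k : ℕ) : C(X, ℝ) :=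
  ⟨fun x => dist (D k) x, by fun_prop⟩

/-- A rational polynomial in the functions `dist (D k) ·`. -/
noncomputable def distPolynomial {X : Type*} [MetricSpace X] (x₀ : X) (D : ℕ → X) (p : MvPolynomial ℕ ℚ) :
    PointedContFun X x₀ :=
  (MvPolynomial.aeval (distFun D) p : C(X, ℝ))

/-- Rational polynomials in the distances to the points of a dense sequence are dense. -/
theorem exists_polynomial_dist_lt {X : Type*} [MetricSpace X] [ProperSpace X] {x₀ : X} {D : ℕ → X}
    (hD : DenseRange D) (f : PointedContFun X x₀) {ε : ℝ} (hε : 0 < ε) :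
    ∃ p : MvPolynomial ℕ ℚ, dist (distPolynomial x₀ D p) f < ε := by
  -- Stone–Weierstrass needs a real algebra: the closure of the rational one contains the real
  -- constants because `ℚ` is dense in `ℝ`.
  let S : Subalgebra ℚ C(X, ℝ) := (MvPolynomial.aeval (distFun D)).range
  let B : Subalgebra ℝ C(X, ℝ) :=
    { S.topologicalClosure.toSubsemiring with
      algebraMap_mem' := fun r => by
        have hc : Continuous fun r : ℝ => (algebraMap ℝ C(X, ℝ) r) :=
          continuous_algebraMap ℝ C(X, ℝ)
        refine map_mem_closure (s := range ((↑) : ℚ → ℝ)) hc (Rat.denseRange_cast r) ?_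
        rintro _ ⟨q, rfl⟩
        refine ⟨MvPolynomial.C q, ?_⟩
        ext x
        simp }
  have hB : B.SeparatesPoints := fun x y hxy => by
    obtain ⟨k, hk⟩ := hD.exists_dist_lt x (half_pos (dist_pos.2 hxy))
    refine ⟨distFun D k, ⟨distFun D k, subset_closure ⟨MvPolynomial.X k, by simp⟩, rfl⟩, ?_⟩
    intro h
    have h1 : dist (D k) x = dist (D k) y := h
    have h2 := dist_triangle_left x y (D k)
    rw [← h1, dist_comm (D k) x] at h2
    linarith
  have hK := isCompact_closedBall x₀ (1 / (ε / 2))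
  obtain ⟨g, hg, hgf⟩ :=
    ContinuousMap.exists_mem_subalgebra_near_continuous_of_isCompact_of_separatesPoints hB
      (show C(X, ℝ) from f) hK (show 0 < ε / 4 by positivity)
  have hg' : g ∈ closure (S : Set C(X, ℝ)) := hg
  have hev := Metric.tendstoUniformlyOn_iff.1
    (ContinuousMap.tendsto_iff_forall_isCompact_tendstoUniformlyOn.1 (tendsto_id (x := 𝓝 g)) _ hK)
    (ε / 4) (by positivity)
  obtain ⟨_, ⟨p, rfl⟩, hp⟩ := ((mem_closure_iff_frequently.1 hg').and_eventually hev).exists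
  refine ⟨p, (PointedContFun.dist_le_of_forall_abs_le (half_pos hε) fun x hx => ?_).trans_lt
    (half_lt_self hε)⟩
  have h1 := hp x hx.le
  have h2 : |g x - f x| < ε / 4 := hgf x hx.le
  rw [dist_comm, Real.dist_eq] at h1
  have h3 := abs_sub_le (MvPolynomial.aeval (distFun D) p x) (g x) (f x)
  exact h3.trans (by simp only [id_eq] at h1; exact (add_le_add h1.le h2.le).trans (by linarith))

variable {Ω : Type*} [MeasurableSpace Ω] {X : Ω → Type*} [∀ ω, MetricSpace (X ω)]
  {L : Set (∀ ω, X ω)} {x₀ : ∀ ω, X ω}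

theorem measurable_aeval_distFun {D : ℕ → ∀ ω, X ω} {x : ∀ ω, X ω}
    (h : ∀ k, Measurable fun ω => dist (D k ω) (x ω)) (p : MvPolynomial ℕ ℚ) :
    Measurable fun ω => MvPolynomial.aeval (distFun fun k => D k ω) p (x ω) := by
  induction p using MvPolynomial.induction_on with
  | C a => simp
  | add p q hp hq =>
    simp only [map_add, ContinuousMap.add_apply]
    exact hp.add hq
  | mul_X p k hp =>
    simp only [map_mul, MvPolynomial.aeval_X, ContinuousMap.mul_apply]
    exact hp.mul (h k)

variable [∀ ω, ProperSpace (X ω)]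

/-- By continuity on open balls, a non-strict bound at the points `D n` holds on the whole ball, and
rational radii suffice. -/
theorem measurable_dist_contFun (hL : IsBorelStructure L) (hx₀ : x₀ ∈ L)
    {f g : ∀ ω, PointedContFun (X ω) (x₀ ω)} (hf : f ∈ contFunStructure L x₀)
    (hg : g ∈ contFunStructure L x₀) : Measurable fun ω => dist (f ω) (g ω) := by
  obtain ⟨D, hDL, hD⟩ := hL.separable
  refine measurable_of_Iio fun a => ?_
  have : (fun ω => dist (f ω) (g ω)) ⁻¹' Iio a =
      ⋃ q : {q : ℚ // (0 : ℝ) < q ∧ (q : ℝ) < a}, ⋂ n : ℕ, {ω | dist (D n ω) (x₀ ω) < 1 / (q : ℝ) →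
        |f ω (D n ω) - g ω (D n ω)| ≤ (q : ℝ)} := by
    ext ω
    simp only [mem_preimage, mem_Iio, mem_iUnion, mem_iInter, mem_ofPred_eq]
    constructor
    · intro h
      obtain ⟨q, hq, hqa⟩ := exists_rat_btwn h
      exact ⟨⟨q, dist_nonneg.trans_lt hq, hqa⟩, fun n hn =>
        (PointedContFun.abs_lt_of_dist_lt hq hn).le⟩
    · rintro ⟨⟨q, hq0, hqa⟩, hq⟩
      refine (PointedContFun.dist_le_of_forall_abs_le hq0 fun x hx => ?_).trans_lt hqa
      by_contra! hlt
      have hc : Continuous fun x => |f ω x - g ω x| :=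
        ((f ω).continuous_coe.sub (g ω).continuous_coe).abs
      have hd : DenseRange fun n => D n ω := dense_iff_closure_eq.2 (hD ω)
      obtain ⟨n, hn1, hn2⟩ := hd.exists_mem_open
        (Metric.isOpen_ball.inter (isOpen_lt continuous_const hc)) ⟨x, Metric.mem_ball.2 hx, hlt⟩
      exact (hq n hn1).not_gt hn2
  rw [this]
  refine MeasurableSet.iUnion fun q => MeasurableSet.iInter fun n => MeasurableSet.imp ?_ ?_
  · exact measurableSet_lt (hL.compatible _ (hDL n) _ hx₀) measurable_const
  · exact measurableSet_le (continuous_abs.measurable.comp ((hf _ (hDL n)).sub (hg _ (hDL n))))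
      measurable_const

theorem exists_dense_contFun (hL : IsBorelStructure L) (x₀ : ∀ ω, X ω) :
    ∃ F : ℕ → ∀ ω, PointedContFun (X ω) (x₀ ω), (∀ n, F n ∈ contFunStructure L x₀) ∧
      ∀ ω, closure (range fun n => F n ω) = univ := by
  obtain ⟨D, hDL, hD⟩ := hL.separable
  have : Countable (MvPolynomial ℕ ℚ) := by
    rw [← Cardinal.mk_le_aleph0_iff]
    exact MvPolynomial.cardinalMk_le_max.trans (by simp)
  obtain ⟨e, he⟩ := exists_surjective_nat (MvPolynomial ℕ ℚ)
  refine ⟨fun n ω => distPolynomial (x₀ ω) (fun k => D k ω) (e n),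
    fun n x hx => measurable_aeval_distFun (fun k => hL.compatible _ (hDL k) _ hx) (e n),
    fun ω => eq_univ_of_forall fun f => Metric.mem_closure_iff.2 fun ε hε => ?_⟩
  obtain ⟨p, hp⟩ := exists_polynomial_dist_lt (dense_iff_closure_eq.2 (hD ω)) f hε
  obtain ⟨n, rfl⟩ := he p
  exact ⟨_, ⟨n, rfl⟩, by rwa [dist_comm]⟩

/-- For maximality, `h(x) < a` is detected by an `F n` within a rational `q` of `h` with `F n (x) <
a - q`; the condition `d(x, x₀) < 1/q` makes the metric control the values at `x`. -/
theorem isBorelStructure_contFun (hL : IsBorelStructure L) (hx₀ : x₀ ∈ L) :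
    IsBorelStructure (contFunStructure L x₀) := by
  refine ⟨fun f hf g hg => measurable_dist_contFun hL hx₀ hf hg, fun h hh x hx => ?_,
    exists_dense_contFun hL x₀⟩
  obtain ⟨F, hFL, hF⟩ := exists_dense_contFun hL x₀
  refine measurable_of_Iio fun a => ?_
  have : (fun ω => h ω (x ω)) ⁻¹' Iio a = ⋃ (n : ℕ) (q : ℚ),
      {ω | dist (F n ω) (h ω) < q ∧ F n ω (x ω) < a - q ∧ dist (x ω) (x₀ ω) < 1 / (q : ℝ)} := by
    ext ω
    simp only [mem_preimage, mem_Iio, mem_iUnion, mem_ofPred_eq]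
    constructor
    · intro hlt
      have hd : 0 < dist (x ω) (x₀ ω) + 1 := by positivity
      obtain ⟨q, hq0, hq⟩ := exists_rat_btwn
        (show (0 : ℝ) < min ((a - h ω (x ω)) / 2) (1 / (dist (x ω) (x₀ ω) + 1)) from
          lt_min (half_pos (sub_pos.2 hlt)) (by positivity))
      have hq1 := hq.trans_le (min_le_left _ _)
      have hq2 := hq.trans_le (min_le_right _ _)
      obtain ⟨_, ⟨n, rfl⟩, hn⟩ := Metric.mem_closure_iff.1
        (show h ω ∈ closure (range fun n => F n ω) from hF ω ▸ mem_univ _) q hq0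
      rw [dist_comm] at hn
      have hx1 : dist (x ω) (x₀ ω) < 1 / (q : ℝ) := 
        (lt_add_one _).trans ((lt_one_div hq0 hd).1 hq2)
      have := abs_lt.1 (PointedContFun.abs_lt_of_dist_lt hn hx1)
      exact ⟨n, q, hn, by linarith, hx1⟩
    · rintro ⟨n, q, h1, h2, h3⟩
      have := abs_lt.1 (PointedContFun.abs_lt_of_dist_lt h1 h3)
      linarith
  rw [this]
  refine MeasurableSet.iUnion fun n => MeasurableSet.iUnion fun q => ?_
  exact (measurableSet_lt (hh _ (hFL n)) measurable_const).inter
    ((measurableSet_lt (hFL n _ hx) measurable_const).inter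
      (measurableSet_lt (hL.compatible _ hx _ hx₀) measurable_const))

/-- Subtracting the value at `x₀` from a dense sequence of sections at most doubles the error. -/
theorem isBorelSubfield_contFunZero (hL : IsBorelStructure L) (hx₀ : x₀ ∈ L) :
    IsBorelSubfield (contFunStructure L x₀) fun ω => contFunZero (x₀ ω) := by
  obtain ⟨F, hFL, hF⟩ := exists_dense_contFun hL x₀
  have hne : ∀ ω, (contFunZero (x₀ ω)).Nonempty := fun ω => ⟨_, (busemannEmbedding (x₀ ω) (x₀ ω)).2⟩
  refine ⟨by simp [hne], fun n ω => (⟨fun x => F n ω x - F n ω (x₀ ω),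
    (F n ω).continuous_coe.sub continuous_const⟩ : C(X ω, ℝ)), fun n x hx =>
      (hFL n x hx).sub (hFL n x₀ hx₀), fun ω _ => ⟨fun n => sub_self _, fun g hg => ?_⟩⟩
  refine Metric.mem_closure_iff.2 fun ε hε => ?_
  obtain ⟨_, ⟨n, rfl⟩, hn⟩ := Metric.mem_closure_iff.1
    (show g ∈ closure (range fun n => F n ω) from hF ω ▸ mem_univ _) (ε / 4) (by positivity)
  refine ⟨_, ⟨n, rfl⟩, (PointedContFun.dist_le_of_forall_abs_le (half_pos hε)
    fun x hx => ?_).trans_lt (half_lt_self hε)⟩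
  have hle : 1 / (ε / 2) ≤ 1 / (ε / 4) := one_div_le_one_div_of_le (by positivity) (by linarith)
  have h1 := abs_lt.1 (PointedContFun.abs_lt_of_dist_lt hn (hx.trans_le hle))
  have h2 := abs_lt.1 (PointedContFun.abs_lt_of_dist_lt hn
    (show dist (x₀ ω) (x₀ ω) < 1 / (ε / 4) by rw [dist_self]; positivity))
  rw [show g (x₀ ω) = 0 from hg] at h2
  change |g x - (F n ω x - F n ω (x₀ ω))| ≤ ε / 2
  exact abs_le.2 ⟨by linarith, by linarith⟩

theorem isContinuousBorelMorphism_busemannEmbedding (hL : IsBorelStructure L) (hx₀ : x₀ ∈ L) :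
    IsContinuousBorelMorphism L
      (inheritedStructure (contFunStructure L x₀) fun ω => contFunZero (x₀ ω))
      fun ω => busemannEmbedding (x₀ ω) :=
  ⟨fun p hp x hx => (hL.compatible p hp x hx).sub (hL.compatible p hp x₀ hx₀),
    fun _ => continuous_busemannEmbedding⟩

end ContFun

/-! ### The field of boundaries -/

section Boundary

/-- By compactness the images of the escaping points have an ultralimit. It is a Busemann function,
and the bound `a` survives. -/
theorem exists_mem_boundarySet_dist_le {X : Type*} [MetricSpace X] [ProperSpace X] (h : IsCAT0 X)
    {x₀ : X} {g : contFunZero x₀} {a : ℝ} (hp : ∀ k : ℕ, ∃ p, (k : ℝ) < dist p x₀ ∧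
      dist (busemannEmbedding x₀ p) g < a + 1 / (k + 1)) :
    ∃ f ∈ boundarySet x₀, dist f g ≤ a := by
  choose p hpk hpg using hp
  set U : Ultrafilter ℕ := Ultrafilter.of atTop
  have hUle : (U : Filter ℕ) ≤ atTop := Ultrafilter.of_le _
  obtain ⟨f, -, hf⟩ := isCompact_lipschitzZero.ultrafilter_le_nhds
    (U.map fun k => busemannEmbedding x₀ (p k))
    (le_principal_iff.2 (Filter.mem_map.2 (univ_mem' fun k => busemannEmbedding_lipschitz (p k))))
  have hf' : Tendsto (fun k => busemannEmbedding x₀ (p k)) U (𝓝 f) := hf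
  refine ⟨f, mem_boundarySet_of_tendsto h (Tendsto.mono_left ?_ hUle) hf', ?_⟩
  · refine tendsto_atTop_mono (fun k => ?_) tendsto_natCast_atTop_atTop
    rw [dist_comm]
    exact (hpk k).le
  · have hlim : Tendsto (fun k : ℕ => a + 1 / ((k : ℝ) + 1)) U (𝓝 (a + 0)) :=
      (tendsto_const_nhds.add tendsto_one_div_add_atTop_nhds_zero_nat).mono_left hUle
    rw [add_zero] at hlim
    exact le_of_tendsto_of_tendsto' (hf'.dist tendsto_const_nhds) hlim fun k => (hpg k).le

/-- The conditions on `p` are open, so `p` can be taken in the dense sequence; this makes the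
criterion countable. -/
theorem exists_mem_boundarySet_dist_le_iff {X : Type*} [MetricSpace X] [ProperSpace X]
    (h : IsCAT0 X) {x₀ : X} {D : ℕ → X} (hD : DenseRange D) {g : contFunZero x₀} {a : ℝ} :
    (∃ f ∈ boundarySet x₀, dist f g ≤ a) ↔ ∀ k : ℕ, ∃ n, (k : ℝ) < dist (D n) x₀ ∧
      dist (busemannEmbedding x₀ (D n)) g < a + 1 / (k + 1) := by
  refine ⟨?_, fun H => exists_mem_boundarySet_dist_le h fun k => (H k).imp' D fun _ => id⟩
  rintro ⟨f, hf, hfg⟩ k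
  obtain ⟨p, hpk, hpf⟩ := (mem_boundarySet_iff h).1 hf k (1 / (k + 1)) Nat.one_div_pos_of_nat
  have hpg : dist (busemannEmbedding x₀ p) g < a + 1 / (k + 1) := by
    linarith [dist_triangle (busemannEmbedding x₀ p) f g]
  exact hD.exists_mem_open
    ((isOpen_lt continuous_const (continuous_id.dist continuous_const)).inter
      (isOpen_lt (continuous_busemannEmbedding.dist continuous_const) continuous_const))
    ⟨p, hpk, hpg⟩

variable {Ω : Type*} [MeasurableSpace Ω] {X : Ω → Type*} [∀ ω, MetricSpace (X ω)]
  [∀ ω, ProperSpace (X ω)] {L : Set (∀ ω, X ω)} {x₀ : ∀ ω, X ω}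

theorem measurableSet_exists_mem_boundarySet_dist_le (hX : ∀ ω, IsCAT0 (X ω))
    (hL : IsBorelStructure L) (hx₀ : x₀ ∈ L) {g : ∀ ω, contFunZero (x₀ ω)}
    (hg : g ∈ inheritedStructure (contFunStructure L x₀) fun ω => contFunZero (x₀ ω)) (a : ℝ) :
    MeasurableSet {ω | ∃ f ∈ boundarySet (x₀ ω), dist f (g ω) ≤ a} := by
  obtain ⟨D, hDL, hD⟩ := hL.separable
  have : {ω | ∃ f ∈ boundarySet (x₀ ω), dist f (g ω) ≤ a} = ⋂ k : ℕ, ⋃ n : ℕ,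
      {ω | (k : ℝ) < dist (D n ω) (x₀ ω) ∧
        dist (busemannEmbedding (x₀ ω) (D n ω)) (g ω) < a + 1 / (k + 1)} := by
    ext ω
    simp only [mem_iInter, mem_iUnion, mem_ofPred_eq]
    exact exists_mem_boundarySet_dist_le_iff (hX ω) (dense_iff_closure_eq.2 (hD ω))
  rw [this]
  refine MeasurableSet.iInter fun k => MeasurableSet.iUnion fun n => ?_
  exact (measurableSet_lt measurable_const (hL.compatible _ (hDL n) _ hx₀)).inter
    (measurableSet_lt (measurable_dist_contFun hL hx₀
      ((isContinuousBorelMorphism_busemannEmbedding hL hx₀).1 _ (hDL n)) hg) measurable_const)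

theorem measurableSet_boundarySet_nonempty (hX : ∀ ω, IsCAT0 (X ω))
    (hL : IsBorelStructure L) (hx₀ : x₀ ∈ L) :
    MeasurableSet {ω | (boundarySet (x₀ ω)).Nonempty} := by
  have hi := (isContinuousBorelMorphism_busemannEmbedding hL hx₀).1 _ hx₀
  convert MeasurableSet.iUnion fun n : ℕ =>
    measurableSet_exists_mem_boundarySet_dist_le hX hL hx₀ hi n using 1
  ext ω
  simp only [mem_iUnion, mem_ofPred_eq]
  constructor
  · rintro ⟨f, hf⟩
    exact (exists_nat_ge (dist f (busemannEmbedding (x₀ ω) (x₀ ω)))).imp fun n hn => ⟨f, hf, hn⟩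
  · rintro ⟨n, f, hf, -⟩
    exact ⟨f, hf⟩

theorem isBorelSubfield_boundarySet (hX : ∀ ω, IsCAT0 (X ω)) (hL : IsBorelStructure L)
    (hx₀ : x₀ ∈ L) :
    IsBorelSubfield (inheritedStructure
      (inheritedStructure (contFunStructure L x₀) fun ω => contFunZero (x₀ ω))
        fun ω => closure (range (busemannEmbedding (x₀ ω))))
      fun ω => {f | f.1 ∈ boundarySet (x₀ ω)} := by
  have hi := isContinuousBorelMorphism_busemannEmbedding hL hx₀
  have hcl : IsBorelStructure (inheritedStructure
      (inheritedStructure (contFunStructure L x₀) fun ω => contFunZero (x₀ ω))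
        fun ω => closure (range (busemannEmbedding (x₀ ω)))) :=
    ((isBorelStructure_contFun hL hx₀).inherited (isBorelSubfield_contFunZero hL hx₀)
      fun ω => ⟨_, (busemannEmbedding (x₀ ω) (x₀ ω)).2⟩).inherited
      (hi.isBorelSubfield_range hL).closure
      fun ω => ⟨_, subset_closure (mem_range_self (x₀ ω))⟩
  -- Compactness supplies the completeness needed for the selection and makes the distance to the
  -- boundary attained.
  have hcpt : ∀ ω, CompactSpace (closure (range (busemannEmbedding (x₀ ω)))) := fun ω =>
    isCompact_iff_compactSpace.1 isCompact_closure_range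
  have hclosed : ∀ ω, IsClosed {f : closure (range (busemannEmbedding (x₀ ω))) |
      f.1 ∈ boundarySet (x₀ ω)} := fun ω =>
    (isClosed_boundarySet (hX ω)).preimage continuous_subtype_val
  have hne : ∀ ω, {f : closure (range (busemannEmbedding (x₀ ω))) |
      f.1 ∈ boundarySet (x₀ ω)}.Nonempty ↔ (boundarySet (x₀ ω)).Nonempty := fun ω =>
    ⟨fun ⟨f, hf⟩ => ⟨f.1, hf⟩, fun ⟨f, hf⟩ =>
      ⟨⟨f, boundarySet_subset_closure_range (hX ω) hf⟩, hf⟩⟩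
  have hb := measurableSet_boundarySet_nonempty hX hL hx₀
  refine hcl.isBorelSubfield_of_infDist hclosed (by simpa only [hne] using hb) fun g hg => ?_
  refine measurable_of_Iic fun a => ?_
  -- Where the boundary is empty the distance is `0` by convention, so these `ω` count exactly when
  -- `0 ≤ a`.
  have : (fun ω => Metric.infDist (g ω) {f | f.1 ∈ boundarySet (x₀ ω)}) ⁻¹' Iic a =
      ({ω | (boundarySet (x₀ ω)).Nonempty}ᶜ ∩ {_ω | 0 ≤ a}) ∪
        {ω | ∃ f ∈ boundarySet (x₀ ω), dist f (g ω).1 ≤ a} := by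
    ext ω
    simp only [mem_preimage, mem_Iic, mem_union, mem_inter_iff, mem_compl_iff, mem_ofPred_eq]
    by_cases hω : (boundarySet (x₀ ω)).Nonempty
    · simp only [hω, not_true_eq_false, false_and, false_or]
      constructor
      · intro hle
        obtain ⟨f, hf, hfd⟩ := (hclosed ω).isCompact.exists_infDist_eq_dist ((hne ω).2 hω) (g ω)
        refine ⟨f.1, hf, ?_⟩
        rw [dist_comm]
        exact hfd ▸ hle
      · rintro ⟨f, hf, hfg⟩
        rw [dist_comm] at hfg
        exact (Metric.infDist_le_dist_of_mem
          (show ⟨f, boundarySet_subset_closure_range (hX ω) hf⟩ ∈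
            {f : closure (range (busemannEmbedding (x₀ ω))) | f.1 ∈ boundarySet (x₀ ω)}
            from hf)).trans hfg
    · have h1 := not_nonempty_iff_eq_empty.1 (mt (hne ω).1 hω)
      simp only [hω, not_false_eq_true, true_and, h1, Metric.infDist_empty]
      exact ⟨Or.inl, fun h => h.elim id fun ⟨f, hf, _⟩ => (hω ⟨f, hf⟩).elim⟩
  rw [this]
  exact (hb.compl.inter (MeasurableSet.const _)).union
    (measurableSet_exists_mem_boundarySet_dist_le hX hL hx₀ hg a)

end Boundary

theorem mainTheorem5 {Ω : Type*} [MeasurableSpace Ω] (X : Ω → Type*)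
    [∀ ω, MetricSpace (X ω)] [∀ ω, ProperSpace (X ω)] (hX : ∀ ω, IsCAT0 (X ω))
    (L : Set (∀ ω, X ω)) (hL : IsBorelStructure L) (x₀ : ∀ ω, X ω) (hx₀ : x₀ ∈ L) :
    let LC : Set (∀ ω, PointedContFun (X ω) (x₀ ω)) := contFunStructure L x₀
    let LC₀ : Set (∀ ω, contFunZero (x₀ ω)) :=
      inheritedStructure LC (fun ω => contFunZero (x₀ ω))
    let i : ∀ ω, X ω → contFunZero (x₀ ω) := fun ω => busemannEmbedding (x₀ ω)
    let closureImage : ∀ ω, Set (contFunZero (x₀ ω)) := fun ω => closure (range (i ω))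
    let Lcl : Set (∀ ω, closureImage ω) := inheritedStructure LC₀ closureImage
    -- the fields in question are Borel fields
    (IsBorelStructure LC ∧ IsBorelSubfield LC (fun ω => contFunZero (x₀ ω)) ∧
      IsBorelStructure LC₀ ∧ IsBorelStructure Lcl) ∧
    -- the Busemann embedding is a continuous morphism with Borel image and image closure
    (IsContinuousBorelMorphism L LC₀ i ∧
      IsBorelSubfield LC₀ (fun ω => range (i ω)) ∧
      IsBorelSubfield LC₀ closureImage) ∧
    -- points at infinity correspond bijectively to their Busemann functions based at `x₀`, which
    -- lie in the closure of the image
    ((∀ ω, ∀ ξ : VisualBoundary (X ω),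
        ∃! f : contFunZero (x₀ ω), IsBusemannFunction (x₀ ω) ξ f.1) ∧
      (∀ ω, ∀ ξ η : VisualBoundary (X ω), ∀ f : contFunZero (x₀ ω),
        IsBusemannFunction (x₀ ω) ξ f.1 → IsBusemannFunction (x₀ ω) η f.1 → ξ = η) ∧
      (∀ ω, boundarySet (x₀ ω) ⊆ closureImage ω)) ∧
    -- the field of boundaries is a Borel subfield of closed sets of the closure of the image
    ((∀ ω, IsClosed {f : closureImage ω | f.1 ∈ boundarySet (x₀ ω)}) ∧
      IsBorelSubfield Lcl (fun ω => {f : closureImage ω | f.1 ∈ boundarySet (x₀ ω)})) := by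
  have hLC := isBorelStructure_contFun hL hx₀
  have hC₀ := isBorelSubfield_contFunZero hL hx₀
  have hLC₀ := hLC.inherited hC₀ fun ω => ⟨_, (busemannEmbedding (x₀ ω) (x₀ ω)).2⟩
  have hi := isContinuousBorelMorphism_busemannEmbedding hL hx₀
  have hr := hi.isBorelSubfield_range hL
  exact ⟨⟨hLC, hC₀, hLC₀, hLC₀.inherited hr.closure
      fun ω => ⟨_, subset_closure (mem_range_self (x₀ ω))⟩⟩,
    ⟨hi, hr, hr.closure⟩,
    ⟨fun ω => existsUnique_isBusemannFunction (hX ω),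
      fun ω _ _ _ => eq_of_isBusemannFunction (hX ω),
      fun ω => boundarySet_subset_closure_range (hX ω)⟩,
    fun ω => (isClosed_boundarySet (hX ω)).preimage continuous_subtype_val,
    isBorelSubfield_boundarySet hX hL hx₀⟩
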